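/- **Global and linear convergence of the block-coordinate method for the sharing problem.** Let $n\ge 0$, $N\ge 1$, $[N]=\{1,\dots,N\}$, and consider $$\Phi(\boldsymbol x)=\frac1N\sum_{i=1}^N f_i(x_i)+g\Bigl(\sum_{i=1}^N x_i\Bigr),\qquad \boldsymbol x=(x_1,\dots,x_N)\in\mathbb R^{nN},$$ where each $f_i:\mathbb R^n\to\mathbb R$ is differentiable with $L_i$-Lipschitz gradient ($L_i\ge0$), and $g:\mathbb R^n\to\mathbb R\cup\{\infty\}$ is proper, convex and lower semicontinuous. Suppose that $\Phi$ is coercive, i.e. $\Phi(\boldsymbol x)\to\infty$ as $\|\boldsymbol x\|\to\infty$, and that $\Phi$ has the Kurdyka–Łojasiewicz property with exponent $\theta\in(0,1)$: for every $\bar{\boldsymbol w}$ with $\partial\Phi(\bar{\boldsymbol w})\neq\emptyset$ there are $\varepsilon,\eta,\varrho>0$ such that, with $\psi(s)=\varrho s^{1-\theta}$, $$\psi'\bigl(\Phi(\boldsymbol w)-\Phi(\bar{\boldsymbol w})\bigr)\operatorname{dist}\bigl(0,\partial\Phi(\boldsymbol w)\bigr)\ge1$$ whenever $\|\boldsymbol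 w-\bar{\boldsymbol w}\|<\varepsilon$ and $\Phi(\bar{\boldsymbol w})<\Phi(\boldsymbol w)<\Phi(\bar{\boldsymbol w})+\eta$. Here $\partial$ is the limiting subdifferential, $\hat\partial$ denotes the regular (Fréchet) subdifferential, and $\operatorname{dist}(0,\emptyset)=\infty$. Let $\gamma_i\in(0,N/L_i)$ for $i\in[N]$ (with $N/0=\infty$), $\tilde\gamma=\sum_{i=1}^N\gamma_i$, and let $\operatorname{prox}_{\tilde\gamma g}(u)=\operatorname{argmin}_{v}\{g(v)+\tfrac1{2\tilde\gamma}\|v-u\|^2\}$. Given $x_1^{\rm init},\dots,x_N^{\rm init}\in\mathbb R^n$, set $s_i^0=x_i^{\rm init}-\frac{\gamma_i}N\nabla f_i(x_i^{\rm init})$ and $\tilde s^0=\sum_{i=1}^N s_i^0$, and for $k=0,1,2,\dots$ select a set $I^{k+1}\subseteq[N]$, take $w^k\in\tilde\gamma^{-1}\bigl(\operatorname{prox}_{\tilde\gamma g}(\tilde s^k)-\tilde s^k\bigr)$, and let $$s_i^{k+1}=\begin{cases}s_i^k+\gamma_iw^k-\frac{\gamma_i}N\nabla f_i(s_i^k+\gamma_iw^k)&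 i\in I^{k+1},\\ s_i^k& i\notin I^{k+1},\end{cases}\qquad \tilde s^{k+1}=\tilde s^k+\sum_{i\in I^{k+1}}(s_i^{k+1}-s_i^k).$$ Suppose that the sampling is essentially cyclic: there is $T\ge1$ such that every index $i\in[N]$ is selected at least once within any $T$ consecutive iterations. Let $\boldsymbol z^k=(s_1^k+\gamma_1w^k,\dots,s_N^k+\gamma_Nw^k)$. Then, for every such choice of the index sets (that is, surely), $(\boldsymbol z^k)_{k\in\mathbb N}$ converges to a stationary point $\boldsymbol x^\star$ of $\Phi$, i.e. $0\in\hat\partial\Phi(\boldsymbol x^\star)$. Moreover, if $\theta\le\frac12$, then the convergence is $R$-linear: there are $c>0$ and $q\in(0,1)$ such that $\|\boldsymbol z^k-\boldsymbol x^\star\|\le c\,q^k$ for all $k\in\mathbb N$. -/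

import Mathlib

open Filter Topology

namespace Sharing

/-- `ℝⁿ` with its Euclidean norm. -/
abbrev Vec (n : ℕ) : Type := EuclideanSpace ℝ (Fin n)

/-- `ℝ^{nN}`, seen as `N` blocks of `ℝⁿ`, with its Euclidean norm. -/
abbrev Blocks (n N : ℕ) : Type := PiLp 2 (fun _ : Fin N => Vec n)

section ExtendedReal

/-- A proper function with values in `ℝ ∪ {∞}`: it never takes the value `-∞` and is finite
somewhere. -/
def IsProper {E : Type*} (h : E → EReal) : Prop :=
  (∀ x, h x ≠ ⊥) ∧ ∃ x, h x ≠ ⊤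

/-- Convexity of an extended-real-valued function: its epigraph in `E × ℝ` is convex. -/
def IsConvex {E : Type*} [AddCommGroup E] [Module ℝ E] (h : E → EReal) : Prop :=
  Convex ℝ {p : E × ℝ | h p.1 ≤ (p.2 : EReal)}

/-- Coercivity: `h x → ∞` as `‖x‖ → ∞`. -/
def IsCoercive {E : Type*} [NormedAddCommGroup E] (h : E → EReal) : Prop :=
  Tendsto h (Bornology.cobounded E) (𝓝 ⊤)

/-- The proximal mapping `prox_{t h}(x) = argmin_w { h w + (1/(2t)) ‖w - x‖² }`, as a set. -/
def prox {E : Type*} [NormedAddCommGroup E] (t : ℝ) (h : E → EReal) (x : E) : Set E :=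
  {p | ∀ w, h p + ((1 / (2 * t) * ‖p - x‖ ^ 2 : ℝ) : EReal)
    ≤ h w + ((1 / (2 * t) * ‖w - x‖ ^ 2 : ℝ) : EReal)}

/-- The regular (Fréchet) subdifferential: `v ∈ ∂̂h(x)` iff `h x` is finite and
`h w ≥ h x + ⟪v, w - x⟫ + o(‖w - x‖)` as `w → x`. -/
def regSubdiff {E : Type*} [NormedAddCommGroup E] [InnerProductSpace ℝ E]
    (h : E → EReal) (x : E) : Set E :=
  {v | h x ≠ ⊥ ∧ h x ≠ ⊤ ∧ ∀ ε : ℝ, 0 < ε → ∀ᶠ w in 𝓝 x,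
    h x + ((inner ℝ v (w - x) - ε * ‖w - x‖ : ℝ) : EReal) ≤ h w}

/-- The (limiting) subdifferential: limits of regular subgradients `vₖ ∈ ∂̂h(xₖ)` along
sequences `xₖ → x` with `h xₖ → h x`, where `h x` is finite. -/
def subdiff {E : Type*} [NormedAddCommGroup E] [InnerProductSpace ℝ E]
    (h : E → EReal) (x : E) : Set E :=
  {v | h x ≠ ⊥ ∧ h x ≠ ⊤ ∧ ∃ (y : ℕ → E) (u : ℕ → E),
    Tendsto y atTop (𝓝 x) ∧ Tendsto (fun k => h (y k)) atTop (𝓝 (h x)) ∧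
    (∀ k, u k ∈ regSubdiff h (y k)) ∧ Tendsto u atTop (𝓝 v)}

/-- The KL property with exponent `θ` at `a`, with desingularizing function `ψ s = ϱ s^(1-θ)`.
The distance is extended-valued: it is `∞` where the subdifferential is empty. -/
def HasKLAt {E : Type*} [NormedAddCommGroup E] [InnerProductSpace ℝ E]
    (h : E → EReal) (θ : ℝ) (a : E) : Prop :=
  ∃ ε η ϱ : ℝ, 0 < ε ∧ 0 < η ∧ 0 < ϱ ∧
    ∀ w, ‖w - a‖ < ε → h a < h w → h w < h a + (η : EReal) →
      1 ≤ ENNReal.ofReal (deriv (fun s : ℝ => ϱ * s ^ (1 - θ)) (h w - h a).toReal)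
        * Metric.infEDist 0 (subdiff h w)

/-- The KL property with exponent `θ`: it holds at every point of `dom ∂h`. -/
def HasKL {E : Type*} [NormedAddCommGroup E] [InnerProductSpace ℝ E]
    (h : E → EReal) (θ : ℝ) : Prop :=
  ∀ a, (subdiff h a).Nonempty → HasKLAt h θ a

/-- `x` is stationary for `h`: `0 ∈ ∂̂h(x)`. -/
def IsStationary {E : Type*} [NormedAddCommGroup E] [InnerProductSpace ℝ E]
    (h : E → EReal) (x : E) : Prop :=
  (0 : E) ∈ regSubdiff h x

end ExtendedReal

/-- `f` is `L`-smooth: differentiable with `L`-Lipschitz gradient. -/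
def IsSmooth {E : Type*} [NormedAddCommGroup E] [InnerProductSpace ℝ E] [CompleteSpace E]
    (L : NNReal) (f : E → ℝ) : Prop :=
  Differentiable ℝ f ∧ LipschitzWith L (gradient f)

/-- The cost of the sharing problem, `Φ(x) = (1/N) ∑ᵢ fᵢ(xᵢ) + g(∑ᵢ xᵢ)`. -/
noncomputable def cost {n N : ℕ} (f : Fin N → Vec n → ℝ) (g : Vec n → EReal)
    (x : Blocks n N) : EReal :=
  ((1 / (N : ℝ) * ∑ i, f i (x i) : ℝ) : EReal) + g (∑ i, x i)

/-- The forward (gradient) step `u - (γᵢ/N) ∇fᵢ(u)` on the `i`-th block. -/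
noncomputable def forwardStep {n N : ℕ} (f : Fin N → Vec n → ℝ) (γ : Fin N → ℝ)
    (i : Fin N) (u : Vec n) : Vec n :=
  u - (γ i / (N : ℝ)) • gradient (f i) u

/-- A run of the block-coordinate method for the sharing problem. `I k` is the set of indices
selected at iteration `k`; `s k`, `sTilde k` are the values of `s = (s₁,…,s_N)` and `s̃` when
iteration `k` starts, and `w k` is the vector computed in it. The sum `s̃` is only initialized as
`∑ᵢ sᵢ` and is then updated incrementally. -/
structure IsRun {n N : ℕ} (f : Fin N → Vec n → ℝ) (g : Vec n → EReal) (γ : Fin N → ℝ)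
    (I : ℕ → Finset (Fin N)) (xinit : Fin N → Vec n)
    (s : ℕ → Fin N → Vec n) (sTilde w : ℕ → Vec n) : Prop where
  s_zero : ∀ i, s 0 i = forwardStep f γ i (xinit i)
  sTilde_zero : sTilde 0 = ∑ i, s 0 i
  w_mem : ∀ k, ∃ p ∈ prox (∑ i, γ i) g (sTilde k), w k = (∑ i, γ i)⁻¹ • (p - sTilde k)
  s_update : ∀ k, ∀ i ∈ I k, s (k + 1) i = forwardStep f γ i (s k i + γ i • w k)
  s_keep : ∀ k, ∀ i ∉ I k, s (k + 1) i = s k i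
  sTilde_update : ∀ k, sTilde (k + 1) =
    sTilde k + ∑ i ∈ I k, (forwardStep f γ i (s k i + γ i • w k) - s k i)

/-- The output `z = (s₁ + γ₁ w, …, s_N + γ_N w)`. -/
noncomputable def output {n N : ℕ} (γ : Fin N → ℝ) (s : Fin N → Vec n) (w : Vec n) :
    Blocks n N :=
  WithLp.toLp 2 (fun i => s i + γ i • w)

/-- Essentially cyclic sampling: for some `T ≥ 1`, every index is selected at least once within
any `T` consecutive iterations. -/
def EssentiallyCyclic {N : ℕ} (I : ℕ → Finset (Fin N)) : Prop :=
  ∃ T : ℕ, 1 ≤ T ∧ ∀ (i : Fin N) (k : ℕ), ∃ j, k ≤ j ∧ j < k + T ∧ i ∈ I j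

/-- `R`-linear convergence of `z` to `a`: `‖zᵏ - a‖` is dominated by a geometric sequence. -/
def ConvergesRLinearly {E : Type*} [NormedAddCommGroup E] (z : ℕ → E) (a : E) : Prop :=
  ∃ c q : ℝ, 0 < c ∧ 0 < q ∧ q < 1 ∧ ∀ k, ‖z k - a‖ ≤ c * q ^ k

end Sharing

/-!
# Convergence of the block-coordinate method for the sharing problem

Write `F(x) = (1/N) ∑ᵢ fᵢ(xᵢ)`, `G(x) = g(∑ᵢ xᵢ)` and `Γ = diag(γᵢ)`. By Cauchy–Schwarz, the proximal
step of `g` on the sum `s̃` is the proximal step of `G` in the metric `Γ⁻¹` (`isModelMin_output`).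
Hence the method is a block-coordinate forward-backward method: there are iterates `xᵏ`
(`blockIterates`) with `sᵏ = xᵏ - Γ∇F(xᵏ)`, the output `zᵏ` minimizes the model
`y ↦ F(xᵏ) + ⟪∇F(xᵏ), y - xᵏ⟫ + ½‖y - xᵏ‖²_{Γ⁻¹} + G(y)`, and `xᵏ⁺¹` arises from `xᵏ` by copying the
selected blocks of `zᵏ`.

The minimal model value `Vₖ` (the forward-backward envelope at `xᵏ`) is the Lyapunov function.
Testing the model at `xᵏ⁺¹` with `zᵏ` and the descent lemma give
`Vₖ₊₁ ≤ Vₖ - c ‖xᵏ⁺¹ - xᵏ‖²` (`add_sq_le_of_isModelMin`). Since `g` is convex, its proximal mapping is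
nonexpansive, so `zᵏ` depends on `xᵏ` in a Lipschitz way; as every block is updated within `T`
iterations, `‖zᵏ - xᵏ‖` is bounded by the length `Δₖ` of the next `T` steps
(`sum_norm_sub_le_window`).

The KL property is applied to the cost itself at `zᵏ`, not to the envelope: the residual of Fermat's
rule is a subgradient of size `O(‖zᵏ - xᵏ‖)` (`modelResidual_mem_regSubdiff`,
`norm_modelResidual_le`), and `Vₖ` exceeds the cost of `zᵏ` by `O(‖zᵏ - xᵏ‖²)` (`smoothModel_le`).
With `V⋆ = lim Vₖ` and `p = max θ (1/2)` this yields `(Vₖ - V⋆)ᵖ ≤ C ‖zᵏ - xᵏ‖` for large `k`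
(`exists_eventually_rpow_le_of_hasKLAt`); the sequence `zᵏ` is bounded by coercivity, and its cluster
points are stationary with cost `V⋆` (`isModelMin_of_tendsto`).

Combining the error bound with `V_k - V_{k+T} ≥ (c/T) Δₖ²`, concavity of `τ ↦ τ¹⁻ᵖ` bounds
`Δₖ` by a decrease of `(Vₖ - V⋆)¹⁻ᵖ`, which telescopes: the iterates have finite length, and the
distance to their limit is `O((Vₖ - V⋆)¹⁻ᵖ)`. If `p = 1/2`, the same two inequalities make
`Vₖ - V⋆` contract over windows of length `T`, and the rate follows (`exists_tendsto_of_window`).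
-/

namespace Sharing

/-! ### Real sequences -/

/-- If `a ^ p ≤ C d` and the decrease from `a` to `b` is at least `c d²`, then `d` is bounded by the
decrease of the desingularizing function `t ↦ t ^ (1 - p)`. -/
theorem le_rpow_sub_rpow_of_sq_le_sub {p a b c C d : ℝ} (hp0 : 0 < p) (hp1 : p < 1)
    (hb : 0 ≤ b) (hc : 0 < c) (hC : 0 < C) (hd : 0 ≤ d) (h1 : a ^ p ≤ C * d)
    (h2 : c * d ^ 2 ≤ a - b) :
    d ≤ C / (c * (1 - p)) * (a ^ (1 - p) - b ^ (1 - p)) := by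
  have hp : 0 < 1 - p := by linarith
  have hcd : 0 ≤ c * d ^ 2 := by positivity
  have hba : b ≤ a := by linarith
  rcases hd.eq_or_lt with rfl | hd
  · have := Real.rpow_le_rpow hb hba hp.le
    exact mul_nonneg (by positivity) (by linarith)
  have ha : 0 < a := by nlinarith [pow_pos hd 2]
  have hap : 0 < a ^ p := Real.rpow_pos_of_pos ha p
  -- tangent-line bound for the concave function `t ↦ t ^ (1 - p)` at `a`
  have key : (1 - p) * (a - b) ≤ a ^ p * (a ^ (1 - p) - b ^ (1 - p)) := by
    have h := rpow_one_add_le_one_add_mul_self (s := b / a - 1)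
      (by have : 0 ≤ b / a := by positivity
          linarith) hp.le (by linarith)
    rw [add_sub_cancel, Real.div_rpow hb ha.le] at h
    have hx : 0 < a ^ (1 - p) := Real.rpow_pos_of_pos ha _
    have hmul : a ^ p * a ^ (1 - p) = a := by
      rw [← Real.rpow_add ha]; simp
    rw [div_le_iff₀ hx] at h
    have h3 := mul_le_mul_of_nonneg_left h hap.le
    have h4 : a ^ p * ((1 + (1 - p) * (b / a - 1)) * a ^ (1 - p)) = a + (1 - p) * (b - a) := by
      calc _ = (1 + (1 - p) * (b / a - 1)) * (a ^ p * a ^ (1 - p)) := by ring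
        _ = _ := by rw [hmul]; field_simp
    rw [h4] at h3
    rw [mul_sub (a ^ p), hmul]; linarith
  have hD : 0 ≤ a ^ (1 - p) - b ^ (1 - p) := sub_nonneg.2 (Real.rpow_le_rpow hb hba hp.le)
  have h5 : (1 - p) * (c * d ^ 2) ≤ C * d * (a ^ (1 - p) - b ^ (1 - p)) :=
    (mul_le_mul_of_nonneg_left h2 hp.le).trans (key.trans (mul_le_mul_of_nonneg_right h1 hD))
  rw [div_mul_eq_mul_div, le_div_iff₀ (by positivity)]
  refine le_of_mul_le_mul_left ?_ hd
  nlinarith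

/-- Finite-length estimate. The desingularized values telescope along windows of length `T`. -/
theorem sum_range_le_of_window {p c C : ℝ} {T K : ℕ} {e δ : ℕ → ℝ} (hp0 : 0 < p) (hp1 : p < 1)
    (hc : 0 < c) (hC : 0 < C) (hT : 1 ≤ T) (he : ∀ k, 0 ≤ e k) (hδ : ∀ k, 0 ≤ δ k)
    (h1 : ∀ k ≥ K, e k ^ p ≤ C * ∑ j ∈ Finset.range T, δ (k + j))
    (h2 : ∀ k, c * (∑ j ∈ Finset.range T, δ (k + j)) ^ 2 ≤ e k - e (k + T))
    (k : ℕ) (hk : K ≤ k) (m : ℕ) :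
    ∑ j ∈ Finset.range m, δ (k + j) ≤ C / (c * (1 - p)) * e k ^ (1 - p) := by
  have hA : 0 ≤ C / (c * (1 - p)) := by
    have : 0 < 1 - p := by linarith
    positivity
  have key : ∀ ν : ℕ, ∑ j ∈ Finset.range (ν * T), δ (k + j) ≤
      C / (c * (1 - p)) * (e k ^ (1 - p) - e (k + ν * T) ^ (1 - p)) := by
    intro ν
    induction ν with
    | zero => simp
    | succ ν ih =>
      have := le_rpow_sub_rpow_of_sq_le_sub hp0 hp1 (he (k + ν * T + T)) hc hC
        (Finset.sum_nonneg fun j _ => hδ (k + ν * T + j))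
        (h1 (k + ν * T) (by omega)) (h2 (k + ν * T))
      rw [add_mul, one_mul, Finset.sum_range_add]
      simp only [← add_assoc]
      linarith
  calc ∑ j ∈ Finset.range m, δ (k + j)
      ≤ ∑ j ∈ Finset.range (m * T), δ (k + j) :=
        Finset.sum_le_sum_of_subset_of_nonneg
          (Finset.range_mono (Nat.le_mul_of_pos_right m hT)) fun _ _ _ => hδ _
    _ ≤ _ := key m
    _ ≤ _ := mul_le_mul_of_nonneg_left
        (sub_le_self _ (Real.rpow_nonneg (he _) _)) hA

/-- A nonincreasing sequence that contracts over windows of length `T` decays geometrically. -/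
theorem exists_le_geometric_of_window {ρ : ℝ} {T K : ℕ} {e : ℕ → ℝ} (hρ0 : 0 < ρ) (hρ1 : ρ < 1)
    (hT : 1 ≤ T) (he : ∀ k, 0 ≤ e k) (hanti : Antitone e)
    (h : ∀ k ≥ K, e (k + T) ≤ ρ * e k) :
    ∃ c q : ℝ, 0 < c ∧ 0 < q ∧ q < 1 ∧ ∀ k, e k ≤ c * q ^ k := by
  have hT0 : (T : ℝ) ≠ 0 := by positivity
  set q : ℝ := ρ ^ (1 / (T : ℝ)) with hq
  have hq0 : 0 < q := Real.rpow_pos_of_pos hρ0 _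
  have hq1 : q < 1 := Real.rpow_lt_one hρ0.le hρ1 (by positivity)
  have hqT : q ^ T = ρ := by
    rw [hq, ← Real.rpow_natCast, ← Real.rpow_mul hρ0.le]
    simp [hT0]
  have key : ∀ ν : ℕ, e (K + ν * T) ≤ q ^ (ν * T) * e 0 := by
    intro ν
    induction ν with
    | zero => simpa using hanti (Nat.zero_le K)
    | succ ν ih =>
      have h3 := h (K + ν * T) (by omega)
      rw [add_mul, one_mul, ← add_assoc, pow_add, hqT]
      calc _ ≤ _ := h3
        _ ≤ ρ * (q ^ (ν * T) * e 0) := mul_le_mul_of_nonneg_left ih hρ0.le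
        _ = _ := by ring
  refine ⟨(e 0 + 1) / q ^ (K + T), q, by have := he 0; positivity, hq0, hq1, fun k => ?_⟩
  have hpow : 0 < q ^ (K + T) := by positivity
  rw [div_mul_eq_mul_div, le_div_iff₀ hpow]
  have he0 := he 0
  have hqk : 0 < q ^ k := by positivity
  rcases le_or_gt k (K + T) with hk | hk
  · calc e k * q ^ (K + T) ≤ e 0 * q ^ k :=
          mul_le_mul (hanti (Nat.zero_le k)) (pow_le_pow_of_le_one hq0.le hq1.le hk) hpow.le he0
      _ ≤ _ := by nlinarith
  · set ν := (k - K) / T with hν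
    have hν1 : ν * T ≤ k - K := Nat.div_mul_le_self _ _
    have hν2 : k - K < ν * T + T := by
      have := Nat.lt_div_mul_add (a := k - K) (b := T) (by omega)
      exact this
    calc e k * q ^ (K + T) ≤ e (K + ν * T) * q ^ (K + T) :=
          mul_le_mul_of_nonneg_right (hanti (by omega)) hpow.le
      _ ≤ q ^ (ν * T) * e 0 * q ^ (K + T) := mul_le_mul_of_nonneg_right (key ν) hpow.le
      _ = q ^ (ν * T + (K + T)) * e 0 := by rw [pow_add]; ring
      _ ≤ q ^ k * e 0 := mul_le_mul_of_nonneg_right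
          (pow_le_pow_of_le_one hq0.le hq1.le (by omega)) he0
      _ ≤ _ := by nlinarith

theorem convergesRLinearly_of_eventually_le {E : Type*} [NormedAddCommGroup E] {z : ℕ → E} {a : E}
    {c q : ℝ} {K : ℕ} (hc : 0 < c) (hq0 : 0 < q) (hq1 : q < 1)
    (h : ∀ k ≥ K, ‖z k - a‖ ≤ c * q ^ k) : ConvergesRLinearly z a := by
  have hS : 0 ≤ ∑ j ∈ Finset.range K, ‖z j - a‖ := Finset.sum_nonneg fun _ _ => norm_nonneg _
  refine ⟨c + (∑ j ∈ Finset.range K, ‖z j - a‖) / q ^ K, q, by positivity, hq0, hq1, fun k => ?_⟩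
  rw [add_mul]
  rcases le_or_gt K k with hk | hk
  · have : 0 ≤ (∑ j ∈ Finset.range K, ‖z j - a‖) / q ^ K * q ^ k := by positivity
    linarith [h k hk]
  · have h1 : ‖z k - a‖ ≤ ∑ j ∈ Finset.range K, ‖z j - a‖ :=
      Finset.single_le_sum (f := fun j => ‖z j - a‖) (fun _ _ => norm_nonneg _)
        (Finset.mem_range.2 hk)
    have h2 : q ^ K ≤ q ^ k := pow_le_pow_of_le_one hq0.le hq1.le hk.le
    have h3 : ∑ j ∈ Finset.range K, ‖z j - a‖ ≤
        (∑ j ∈ Finset.range K, ‖z j - a‖) / q ^ K * q ^ k := by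
      rw [div_mul_eq_mul_div, le_div_iff₀ (by positivity)]
      exact mul_le_mul_of_nonneg_left h2 hS
    have : 0 ≤ c * q ^ k := by positivity
    linarith

/-- Convergence from a Łojasiewicz-type inequality `h1` between the gap `e` of a Lyapunov function
and the steps in the next `T` iterations, and a sufficient decrease `h2` over them. -/
theorem exists_tendsto_of_window {E : Type*} [NormedAddCommGroup E] [CompleteSpace E]
    {p c C : ℝ} {T K : ℕ} {e δ : ℕ → ℝ} {x z : ℕ → E} (hp0 : 0 < p) (hp1 : p < 1)
    (hc : 0 < c) (hC : 0 < C) (hT : 1 ≤ T) (he : ∀ k, 0 ≤ e k) (hanti : Antitone e)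
    (he0 : Tendsto e atTop (𝓝 0))
    (hx : ∀ k, ‖x (k + 1) - x k‖ ≤ δ k)
    (hz : ∀ k, ‖z k - x k‖ ≤ C * ∑ j ∈ Finset.range T, δ (k + j))
    (h1 : ∀ k ≥ K, e k ^ p ≤ C * ∑ j ∈ Finset.range T, δ (k + j))
    (h2 : ∀ k, c * (∑ j ∈ Finset.range T, δ (k + j)) ^ 2 ≤ e k - e (k + T)) :
    ∃ a, Tendsto z atTop (𝓝 a) ∧ (p = 1 / 2 → ConvergesRLinearly z a) := by
  have hδ : ∀ k, 0 ≤ δ k := fun k => (norm_nonneg _).trans (hx k)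
  have hp : 0 < 1 - p := by linarith
  set A : ℝ := C / (c * (1 - p)) with hA
  have hA0 : 0 < A := by positivity
  have hsum := sum_range_le_of_window hp0 hp1 hc hC hT he hδ h1 h2
  have hpow : Tendsto (fun k => e k ^ (1 - p)) atTop (𝓝 0) := by
    have := he0.rpow_const (p := 1 - p) (Or.inr hp.le)
    rwa [Real.zero_rpow hp.ne'] at this
  have hxm : ∀ k m, ‖x (k + m) - x k‖ ≤ ∑ j ∈ Finset.range m, δ (k + j) := by
    intro k m
    induction m with
    | zero => simp
    | succ m ih =>
      rw [Finset.sum_range_succ]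
      have := norm_add_le (x (k + m + 1) - x (k + m)) (x (k + m) - x k)
      rw [sub_add_sub_cancel] at this
      rw [← add_assoc]
      linarith [hx (k + m)]
  have hxle : ∀ k ≥ K, ∀ m, ‖x (k + m) - x k‖ ≤ A * e k ^ (1 - p) :=
    fun k hk m => (hxm k m).trans (hsum k hk m)
  have hcau : CauchySeq x := by
    have hlim : Tendsto (fun k => 2 * (A * e (k + K) ^ (1 - p))) atTop (𝓝 0) := by
      simpa using (((hpow.comp (tendsto_add_atTop_nat K)).const_mul A).const_mul 2)
    have : CauchySeq fun k => x (k + K) := by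
      refine cauchySeq_of_le_tendsto_0 _ (fun n m N hn hm => ?_) hlim
      have h3 := hxle (N + K) (by omega) (n - N)
      have h4 := hxle (N + K) (by omega) (m - N)
      rw [show N + K + (n - N) = n + K by omega] at h3
      rw [show N + K + (m - N) = m + K by omega] at h4
      have := dist_triangle_right (x (n + K)) (x (m + K)) (x (N + K))
      rw [dist_eq_norm, dist_eq_norm, dist_eq_norm] at this
      rw [dist_eq_norm]
      linarith
    exact (cauchySeq_shift K).1 this
  obtain ⟨a, ha⟩ := cauchySeq_tendsto_of_complete hcau
  have hxa : ∀ k ≥ K, ‖x k - a‖ ≤ A * e k ^ (1 - p) := by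
    intro k hk
    have h3 : Tendsto (fun m => ‖x (k + m) - x k‖) atTop (𝓝 ‖a - x k‖) := by
      have := ha.comp (tendsto_add_atTop_nat k)
      simp only [Function.comp_def, add_comm _ k] at this
      exact (this.sub_const _).norm
    rw [norm_sub_rev]
    exact le_of_tendsto h3 (Eventually.of_forall (hxle k hk))
  have hzx : ∀ k ≥ K, ‖z k - x k‖ ≤ C * (A * e k ^ (1 - p)) := fun k hk =>
    (hz k).trans (mul_le_mul_of_nonneg_left (hsum k hk T) hC.le)
  have hza : ∀ k ≥ K, ‖z k - a‖ ≤ (C + 1) * A * e k ^ (1 - p) := by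
    intro k hk
    have := norm_add_le (z k - x k) (x k - a)
    rw [sub_add_sub_cancel] at this
    linarith [hxa k hk, hzx k hk]
  refine ⟨a, ?_, ?_⟩
  · rw [tendsto_iff_norm_sub_tendsto_zero]
    refine squeeze_zero' (Eventually.of_forall fun _ => norm_nonneg _)
      ((eventually_ge_atTop K).mono hza) ?_
    simpa using hpow.const_mul ((C + 1) * A)
  · intro hphalf
    subst hphalf
    -- squaring `h1` turns the two hypotheses into a contraction of `e`
    set B : ℝ := max (C ^ 2 / c) 2 with hB
    have hB2 : 2 ≤ B := le_max_right _ _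
    have hcontr : ∀ k ≥ K, e (k + T) ≤ (1 - 1 / B) * e k := by
      intro k hk
      have h3 := h1 k hk
      have h4 : e k ≤ C ^ 2 * (∑ j ∈ Finset.range T, δ (k + j)) ^ 2 := by
        rw [← Real.sqrt_eq_rpow] at h3
        rw [← mul_pow]
        calc e k = (√(e k)) ^ 2 := (Real.sq_sqrt (he k)).symm
          _ ≤ _ := by gcongr
      have h5 : C ^ 2 ≤ B * c := by
        rw [← div_le_iff₀ hc]; exact le_max_left _ _
      have h6 : e k ≤ B * (e k - e (k + T)) := by
        calc e k ≤ _ := h4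
          _ ≤ B * c * (∑ j ∈ Finset.range T, δ (k + j)) ^ 2 := by gcongr
          _ = B * (c * (∑ j ∈ Finset.range T, δ (k + j)) ^ 2) := by ring
          _ ≤ _ := by gcongr; exact h2 k
      have h7 : e k / B ≤ e k - e (k + T) := by
        rw [div_le_iff₀ (by linarith)]; linarith
      have : (1 - 1 / B) * e k = e k - e k / B := by ring
      linarith
    have hB3 : 1 / B ≤ 1 / 2 := one_div_le_one_div_of_le (by norm_num) hB2
    have hB4 : 0 < 1 / B := by positivity
    obtain ⟨c', q, hc', hq0, hq1, hq⟩ := exists_le_geometric_of_window (ρ := 1 - 1 / B)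
      (by linarith) (by linarith) hT he hanti hcontr
    refine convergesRLinearly_of_eventually_le (c := (C + 1) * A * √c') (q := √q) (K := K)
      (by positivity) (by positivity) (by rw [Real.sqrt_lt' one_pos]; simpa using hq1) ?_
    intro k hk
    refine (hza k hk).trans ?_
    rw [mul_assoc ((C + 1) * A)]
    refine mul_le_mul_of_nonneg_left ?_ (by positivity)
    rw [show (1 : ℝ) - 1 / 2 = 1 / 2 by norm_num, ← Real.sqrt_eq_rpow]
    refine Real.sqrt_le_iff.2 ⟨by positivity, ?_⟩
    rw [mul_pow, ← pow_mul, mul_comm k 2, pow_mul, Real.sq_sqrt hc'.le, Real.sq_sqrt hq0.le]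
    exact hq k

/-! ### Smooth functions -/

section Smooth

variable {E : Type*} [NormedAddCommGroup E] [InnerProductSpace ℝ E] [CompleteSpace E]

theorem IsSmooth.norm_gradient_sub_le {L : NNReal} {f : E → ℝ} (hf : IsSmooth L f) (x y : E) :
    ‖gradient f x - gradient f y‖ ≤ L * ‖x - y‖ := by
  simpa [dist_eq_norm] using hf.2.dist_le_mul x y

/-- The quadratic bound on the linearization error of an `L`-smooth function. -/
theorem IsSmooth.abs_sub_linearization_le {L : NNReal} {f : E → ℝ} (hf : IsSmooth L f) (x y : E) :
    |f y - (f x + inner ℝ (gradient f x) (y - x))| ≤ L / 2 * ‖y - x‖ ^ 2 := by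
  set d := y - x with hd
  have hline : ∀ t : ℝ, HasDerivAt (fun t : ℝ => x + t • d) d t := fun t => by
    simpa using ((hasDerivAt_id t).smul_const d).const_add x
  have hder : ∀ t : ℝ, HasDerivAt (fun t : ℝ => f (x + t • d) - f x - t * inner ℝ (gradient f x) d)
      (inner ℝ (gradient f (x + t • d)) d - inner ℝ (gradient f x) d) t := fun t => by
    have h1 := ((hf.1 (x + t • d)).hasGradientAt.hasFDerivAt).comp_hasDerivAt t (hline t)
    have h2 := (h1.sub_const (f x)).fun_sub ((hasDerivAt_id t).mul_const (inner ℝ (gradient f x) d))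
    simpa [Function.comp_def] using h2
  have hB : ∀ t : ℝ, HasDerivAt (fun t : ℝ => L / 2 * ‖d‖ ^ 2 * t ^ 2) (L * ‖d‖ ^ 2 * t) t :=
    fun t => by
      have := (hasDerivAt_pow 2 t).const_mul ((L : ℝ) / 2 * ‖d‖ ^ 2)
      refine this.congr_deriv ?_
      simp only [Nat.cast_ofNat, Nat.add_one_sub_one, pow_one]
      ring
  have key := image_norm_le_of_norm_deriv_right_le_deriv_boundary (a := 0) (b := 1)
    (fun t _ => (hder t).continuousAt.continuousWithinAt) (fun t _ => (hder t).hasDerivWithinAt)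
    (by simp) hB (fun t ht => by
      rw [← inner_sub_left]
      refine (norm_inner_le_norm _ _).trans ?_
      have h1 := hf.norm_gradient_sub_le (x + t • d) x
      rw [add_sub_cancel_left, norm_smul, Real.norm_of_nonneg ht.1] at h1
      calc _ ≤ L * (t * ‖d‖) * ‖d‖ := mul_le_mul_of_nonneg_right h1 (norm_nonneg _)
        _ = _ := by ring) (Set.right_mem_Icc.2 zero_le_one)
  have hy : x + (1 : ℝ) • d = y := by simp [hd]
  rw [hy, Real.norm_eq_abs] at key
  simpa [sub_sub] using key

end Smooth

/-! ### The proximal mapping -/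

section Prox

variable {E : Type*} [NormedAddCommGroup E]

theorem add_coe_eq_top_iff {a : EReal} {r : ℝ} : a + (r : EReal) = ⊤ ↔ a = ⊤ := by
  induction a with
  | bot => simp
  | top => simp
  | coe a => simp only [← EReal.coe_add, EReal.coe_ne_top]

theorem exists_coe_eq_of_mem_prox {t : ℝ} {g : E → EReal} (hg : IsProper g) {u p : E}
    (hp : p ∈ prox t g u) : ∃ a : ℝ, g p = a := by
  obtain ⟨hbot, x, hx⟩ := hg
  have htop : g p ≠ ⊤ := by
    intro h
    have h1 := hp x
    rw [h, EReal.top_add_coe, top_le_iff, add_coe_eq_top_iff] at h1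
    exact hx h1
  exact ⟨(g p).toReal, (EReal.coe_toReal htop (hbot p)).symm⟩

theorem prox_le_of_le {t : ℝ} {g : E → EReal} {u p : E} (hp : p ∈ prox t g u) {a b : ℝ} {v : E}
    (ha : g p = a) (hb : g v ≤ b) :
    a + 1 / (2 * t) * ‖p - u‖ ^ 2 ≤ b + 1 / (2 * t) * ‖v - u‖ ^ 2 := by
  have h := (hp v).trans (add_le_add_left hb _)
  rw [ha] at h
  exact_mod_cast h

variable [InnerProductSpace ℝ E]

/-- The subgradient inequality `g p' ≥ g p + t⁻¹ ⟪u - p, p' - p⟫` at a proximal point. -/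
theorem sub_le_inner_of_mem_prox {t : ℝ} (ht : 0 < t) {g : E → EReal} (hconv : IsConvex g)
    {u p p' : E} (hp : p ∈ prox t g u) {a a' : ℝ} (ha : g p = a) (ha' : g p' = a') :
    t * (a - a') ≤ inner ℝ (p - u) (p' - p) := by
  have key : ∀ l : ℝ, 0 < l → l < 1 →
      t * (a - a') ≤ inner ℝ (p - u) (p' - p) + l * (‖p' - p‖ ^ 2 / 2) := by
    intro l hl0 hl1
    have hmem := hconv (x := (p, a)) (by simp [ha]) (y := (p', a')) (by simp [ha'])
      (sub_nonneg.2 hl1.le) hl0.le (by ring)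
    have h1 := prox_le_of_le hp ha (v := (1 - l) • p + l • p') (b := (1 - l) * a + l * a') hmem
    have h2 : (1 - l) • p + l • p' - u = (p - u) + l • (p' - p) := by module
    rw [h2, norm_add_sq_real, inner_smul_right, norm_smul, Real.norm_of_nonneg hl0.le] at h1
    have h3 : l * (a - a') ≤ 1 / (2 * t) *
        (2 * (l * inner ℝ (p - u) (p' - p)) + (l * ‖p' - p‖) ^ 2) := by linarith
    have h4 : l * (t * (a - a')) ≤
        l * (inner ℝ (p - u) (p' - p) + l * (‖p' - p‖ ^ 2 / 2)) := by
      have h5 := mul_le_mul_of_nonneg_left h3 ht.le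
      have h6 : t * (1 / (2 * t) *
        (2 * (l * inner ℝ (p - u) (p' - p)) + (l * ‖p' - p‖) ^ 2)) =
        l * (inner ℝ (p - u) (p' - p) + l * (‖p' - p‖ ^ 2 / 2)) := by
        field_simp
      linarith
    exact le_of_mul_le_mul_left h4 hl0
  have hlim : Tendsto (fun l : ℝ => inner ℝ (p - u) (p' - p) + l * (‖p' - p‖ ^ 2 / 2)) (𝓝[>] 0)
      (𝓝 (inner ℝ (p - u) (p' - p))) := by
    have h : Continuous fun l : ℝ => inner ℝ (p - u) (p' - p) + l * (‖p' - p‖ ^ 2 / 2) := by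
      fun_prop
    simpa using (h.tendsto 0).mono_left nhdsWithin_le_nhds
  refine ge_of_tendsto hlim ?_
  filter_upwards [Ioo_mem_nhdsGT (zero_lt_one' ℝ)] with l hl using key l hl.1 hl.2

/-- The proximal mapping of a convex function is nonexpansive. -/
theorem norm_sub_le_of_mem_prox {t : ℝ} (ht : 0 < t) {g : E → EReal} (hg : IsProper g)
    (hconv : IsConvex g) {u u' p p' : E} (hp : p ∈ prox t g u) (hp' : p' ∈ prox t g u') :
    ‖p' - p‖ ≤ ‖u' - u‖ := by
  obtain ⟨a, ha⟩ := exists_coe_eq_of_mem_prox hg hp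
  obtain ⟨a', ha'⟩ := exists_coe_eq_of_mem_prox hg hp'
  have h1 := sub_le_inner_of_mem_prox ht hconv hp ha ha'
  have h2 := sub_le_inner_of_mem_prox ht hconv hp' ha' ha
  have h3 : inner ℝ (p - u) (p' - p) + inner ℝ (p' - u') (p - p') =
      inner ℝ (u' - u) (p' - p) - ‖p' - p‖ ^ 2 := by
    rw [← real_inner_self_eq_norm_sq, ← neg_sub p' p, inner_neg_right, ← sub_eq_add_neg,
      ← inner_sub_left, ← inner_sub_left]
    congr 1
    abel
  have h4 := real_inner_le_norm (u' - u) (p' - p)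
  have h5 : ‖p' - p‖ * ‖p' - p‖ ≤ ‖u' - u‖ * ‖p' - p‖ := by nlinarith
  rcases (norm_nonneg (p' - p)).eq_or_lt with h0 | h0
  · rw [← h0]; exact norm_nonneg _
  · exact le_of_mul_le_mul_right h5 h0

end Prox

/-! ### The proximal-gradient model of the cost -/

section Model

variable {n N : ℕ}

/-- The model at `x` of the smooth part of the cost: its linearization plus the proximal term
`∑ᵢ (1/(2γᵢ)) ‖yᵢ - xᵢ‖²`. -/
noncomputable def smoothModel (f : Fin N → Vec n → ℝ) (γ : Fin N → ℝ) (x y : Blocks n N) : ℝ :=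
  ∑ i, (1 / (N : ℝ) * (f i (x i) + inner ℝ (gradient (f i) (x i)) (y i - x i))
    + 1 / (2 * γ i) * ‖y i - x i‖ ^ 2)

/-- `z` minimizes the model of the cost at `x`, that is, `z` is the result of a
forward-backward step from `x`. -/
def IsModelMin (f : Fin N → Vec n → ℝ) (g : Vec n → EReal) (γ : Fin N → ℝ)
    (x z : Blocks n N) : Prop :=
  ∀ y, (smoothModel f γ x z : EReal) + g (∑ i, z i) ≤ smoothModel f γ x y + g (∑ i, y i)

theorem smoothModel_eq (f : Fin N → Vec n → ℝ) {γ : Fin N → ℝ} (hγ : ∀ i, 0 < γ i)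
    (x y : Blocks n N) :
    smoothModel f γ x y =
      ∑ i, (1 / (N : ℝ) * f i (x i) - γ i / (2 * (N : ℝ) ^ 2) * ‖gradient (f i) (x i)‖ ^ 2)
      + ∑ i, 1 / (2 * γ i) * ‖y i - forwardStep f γ i (x i)‖ ^ 2 := by
  rw [smoothModel, ← Finset.sum_add_distrib]
  refine Finset.sum_congr rfl fun i _ => ?_
  have h : y i - forwardStep f γ i (x i) =
      (y i - x i) + (γ i / (N : ℝ)) • gradient (f i) (x i) := by
    rw [forwardStep]; abel
  have hγi := hγ i
  rw [h, norm_add_sq_real, inner_smul_right, norm_smul, mul_pow, Real.norm_eq_abs, sq_abs,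
    real_inner_comm]
  rcases Nat.eq_zero_or_pos N with hN | hN
  · subst hN; exact i.elim0
  have hN' : (N : ℝ) ≠ 0 := by positivity
  field_simp
  ring

/-- The proximal step on the sum computes the proximal step of `y ↦ g (∑ᵢ yᵢ)` in the metric
weighted by `1/γᵢ`: by Cauchy–Schwarz `∑ᵢ ‖yᵢ - sᵢ‖²/γᵢ ≥ ‖∑ᵢ yᵢ - ∑ᵢ sᵢ‖²/∑ᵢ γᵢ`, with equality
at the output. -/
theorem isModelMin_output (hN : 0 < N) (f : Fin N → Vec n → ℝ) (g : Vec n → EReal) {γ : Fin N → ℝ}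
    (hγ : ∀ i, 0 < γ i) {x : Blocks n N} {s : Fin N → Vec n}
    (hs : ∀ i, s i = forwardStep f γ i (x i)) {p w : Vec n} (hp : p ∈ prox (∑ i, γ i) g (∑ i, s i))
    (hw : w = (∑ i, γ i)⁻¹ • (p - ∑ i, s i)) :
    IsModelMin f g γ x (output γ s w) ∧ ∑ i, output γ s w i = p := by
  have hne : (Finset.univ : Finset (Fin N)).Nonempty := ⟨⟨0, hN⟩, Finset.mem_univ _⟩
  have hG : 0 < ∑ i, γ i := Finset.sum_pos (fun i _ => hγ i) hne
  have hz : ∀ i, output γ s w i = s i + γ i • w := fun i => rfl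
  have hGw : (∑ i, γ i) • w = p - ∑ i, s i := by rw [hw, smul_inv_smul₀ hG.ne']
  have hsum : ∑ i, output γ s w i = p := by
    simp only [hz, Finset.sum_add_distrib, ← Finset.sum_smul, hGw]
    abel
  refine ⟨fun y => ?_, hsum⟩
  have hquad : ∑ i, 1 / (2 * γ i) * ‖output γ s w i - s i‖ ^ 2 =
      1 / (2 * ∑ i, γ i) * ‖p - ∑ i, s i‖ ^ 2 := by
    rw [← hGw, norm_smul, Real.norm_of_nonneg hG.le]
    have h1 : ∀ i, 1 / (2 * γ i) * ‖output γ s w i - s i‖ ^ 2 = γ i * (‖w‖ ^ 2 / 2) := fun i => by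
      have := hγ i
      rw [hz, add_sub_cancel_left, norm_smul, Real.norm_of_nonneg this.le]
      field_simp
    rw [Finset.sum_congr rfl fun i _ => h1 i, ← Finset.sum_mul]
    field_simp
  have hcs : 1 / (2 * ∑ i, γ i) * ‖∑ i, y i - ∑ i, s i‖ ^ 2 ≤
      ∑ i, 1 / (2 * γ i) * ‖y i - s i‖ ^ 2 := by
    have h1 := Finset.sq_sum_div_le_sum_sq_div Finset.univ (fun i => ‖y i - s i‖)
      (g := γ) (fun i _ => hγ i)
    have h2 : ‖∑ i, y i - ∑ i, s i‖ ≤ ∑ i, ‖y i - s i‖ := by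
      rw [← Finset.sum_sub_distrib]; exact norm_sum_le _ _
    have h3 : ‖∑ i, y i - ∑ i, s i‖ ^ 2 ≤ (∑ i, ‖y i - s i‖) ^ 2 := by gcongr
    calc _ ≤ 1 / (2 * ∑ i, γ i) * (∑ i, ‖y i - s i‖) ^ 2 := by gcongr
      _ = 1 / 2 * ((∑ i, ‖y i - s i‖) ^ 2 / ∑ i, γ i) := by field_simp
      _ ≤ 1 / 2 * ∑ i, ‖y i - s i‖ ^ 2 / γ i := by gcongr
      _ = _ := by
        rw [Finset.mul_sum]
        refine Finset.sum_congr rfl fun i _ => ?_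
        have := hγ i
        field_simp
  have hmin := hp (∑ i, y i)
  rw [smoothModel_eq f hγ, smoothModel_eq f hγ]
  simp only [← hs]
  rw [hquad, hsum]
  set K := ∑ i, (1 / (N : ℝ) * f i (x i) - γ i / (2 * (N : ℝ) ^ 2) * ‖gradient (f i) (x i)‖ ^ 2)
  calc ((K + 1 / (2 * ∑ i, γ i) * ‖p - ∑ i, s i‖ ^ 2 : ℝ) : EReal) + g p
      = (K : EReal) + (g p + (1 / (2 * ∑ i, γ i) * ‖p - ∑ i, s i‖ ^ 2 : ℝ)) := by
        rw [EReal.coe_add, add_assoc, add_comm (g p)]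
    _ ≤ (K : EReal) + (g (∑ i, y i) + (1 / (2 * ∑ i, γ i) * ‖∑ i, y i - ∑ i, s i‖ ^ 2 : ℝ)) :=
        add_le_add_right hmin _
    _ ≤ (K : EReal) + (g (∑ i, y i) + (∑ i, 1 / (2 * γ i) * ‖y i - s i‖ ^ 2 : ℝ)) :=
        add_le_add_right (add_le_add_right (EReal.coe_le_coe_iff.2 hcs) _) _
    _ = _ := by rw [EReal.coe_add, add_assoc, add_comm (g _)]

end Model

/-! ### Properties of the model -/

section ModelProperties

variable {n N : ℕ} {f : Fin N → Vec n → ℝ} {g : Vec n → EReal} {γ : Fin N → ℝ} {L : Fin N → NNReal}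

theorem div_lt_one_div_of_stepsize (hN : 0 < N) (hγ : ∀ i, 0 < γ i)
    (hγL : ∀ i, γ i * (L i : ℝ) < N) (i : Fin N) : (L i : ℝ) / N < 1 / γ i := by
  rw [div_lt_div_iff₀ (by exact_mod_cast hN) (hγ i)]
  linarith [hγL i]

theorem norm_le_sum_norm (v : Blocks n N) : ‖v‖ ≤ ∑ i, ‖v i‖ := by
  refine le_of_sq_le_sq ?_ (Finset.sum_nonneg fun _ _ => norm_nonneg _)
  rw [PiLp.norm_sq_eq_of_L2]
  exact Finset.sum_sq_le_sq_sum_of_nonneg fun _ _ => norm_nonneg _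

theorem sum_mul_sq_le_sum_mul_sum_sq {ι : Type*} (s : Finset ι) {a b : ι → ℝ}
    (ha : ∀ i, 0 ≤ a i) :
    ∑ i ∈ s, a i * b i ^ 2 ≤ (∑ i ∈ s, a i) * ∑ i ∈ s, b i ^ 2 := by
  rw [Finset.sum_mul]
  refine Finset.sum_le_sum fun i hi => mul_le_mul_of_nonneg_left ?_ (ha i)
  exact Finset.single_le_sum (f := fun i => b i ^ 2) (fun _ _ => sq_nonneg _) hi

/-- The quadratic bound on the linearization error of one block, scaled by `1/N`. -/
theorem IsSmooth.abs_mul_sub_linearization_le {i : Fin N} (hf : IsSmooth (L i) (f i))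
    (x y : Vec n) :
    |1 / (N : ℝ) * f i y - 1 / (N : ℝ) * (f i x + inner ℝ (gradient (f i) x) (y - x))| ≤
      L i / N / 2 * ‖y - x‖ ^ 2 := by
  have h0 : (0 : ℝ) ≤ 1 / (N : ℝ) := by positivity
  rw [← mul_sub, abs_mul, abs_of_nonneg h0]
  calc _ ≤ 1 / (N : ℝ) * (L i / 2 * ‖y - x‖ ^ 2) :=
        mul_le_mul_of_nonneg_left (hf.abs_sub_linearization_le x y) h0
    _ = _ := by ring

/-- Sufficient decrease. Replacing the blocks of `x` in `S` by those of `z` decreases the value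
of the model at `z`. -/
theorem smoothModel_update_le (hf : ∀ i, IsSmooth (L i) (f i)) {x x' z : Blocks n N}
    {S : Finset (Fin N)} (hin : ∀ i ∈ S, x' i = z i) (hout : ∀ i ∉ S, x' i = x i) :
    smoothModel f γ x' z + ∑ i ∈ S, (1 / γ i - L i / N) / 2 * ‖z i - x i‖ ^ 2 ≤
      smoothModel f γ x z := by
  have h := Finset.sum_ite_mem Finset.univ S
    (fun i => (1 / γ i - L i / N) / 2 * ‖z i - x i‖ ^ 2)
  rw [Finset.univ_inter] at h
  rw [← h, smoothModel, smoothModel, ← Finset.sum_add_distrib]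
  refine Finset.sum_le_sum fun i _ => ?_
  by_cases hi : i ∈ S
  · have h1 := (abs_le.1 ((hf i).abs_mul_sub_linearization_le (x i) (z i))).2
    have h2 : 1 / (2 * γ i) = 1 / γ i / 2 := by ring
    simp only [hin i hi, hi, if_true, sub_self, inner_zero_right, add_zero, norm_zero, h2]
    linarith
  · simp [hout i hi, hi]

theorem smoothModel_self (x : Blocks n N) :
    smoothModel f γ x x = 1 / (N : ℝ) * ∑ i, f i (x i) := by
  simp [smoothModel, Finset.mul_sum]

theorem sum_le_smoothModel (hN : 0 < N) (hf : ∀ i, IsSmooth (L i) (f i)) (hγ : ∀ i, 0 < γ i)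
    (hγL : ∀ i, γ i * (L i : ℝ) < N) (x z : Blocks n N) :
    1 / (N : ℝ) * ∑ i, f i (z i) ≤ smoothModel f γ x z := by
  have h := smoothModel_update_le (γ := γ) hf (x := x) (x' := z) (z := z) (S := Finset.univ)
    (fun _ _ => rfl) (by simp)
  rw [smoothModel_self] at h
  have : 0 ≤ ∑ i, (1 / γ i - L i / N) / 2 * ‖z i - x i‖ ^ 2 :=
    Finset.sum_nonneg fun i _ => by
      have := div_lt_one_div_of_stepsize hN hγ hγL i
      have : 0 ≤ 1 / γ i - L i / N := by linarith
      positivity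
  linarith

theorem smoothModel_le (hN : 0 < N) (hf : ∀ i, IsSmooth (L i) (f i)) (hγ : ∀ i, 0 < γ i)
    (hγL : ∀ i, γ i * (L i : ℝ) < N) (x z : Blocks n N) :
    smoothModel f γ x z ≤
      1 / (N : ℝ) * ∑ i, f i (z i) + (∑ i, 1 / γ i) * (∑ i, ‖z i - x i‖) ^ 2 := by
  have h0 : ∀ i, 0 ≤ 1 / γ i := fun i => by have := hγ i; positivity
  calc smoothModel f γ x z
      ≤ ∑ i, (1 / (N : ℝ) * f i (z i) + 1 / γ i * ‖z i - x i‖ ^ 2) := by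
        refine Finset.sum_le_sum fun i _ => ?_
        have h1 := (abs_le.1 ((hf i).abs_mul_sub_linearization_le (x i) (z i))).1
        have h2 : 1 / (2 * γ i) = 1 / γ i / 2 := by ring
        have h3 := mul_le_mul_of_nonneg_right (div_lt_one_div_of_stepsize hN hγ hγL i).le
          (sq_nonneg ‖z i - x i‖)
        rw [h2]
        linarith
    _ = 1 / (N : ℝ) * ∑ i, f i (z i) + ∑ i, 1 / γ i * ‖z i - x i‖ ^ 2 := by
        rw [Finset.sum_add_distrib, Finset.mul_sum]
    _ ≤ 1 / (N : ℝ) * ∑ i, f i (z i) + (∑ i, 1 / γ i) * ∑ i, ‖z i - x i‖ ^ 2 := by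
        gcongr; exact sum_mul_sq_le_sum_mul_sum_sq _ h0
    _ ≤ _ := by
        gcongr
        · exact Finset.sum_nonneg fun i _ => h0 i
        · exact Finset.sum_sq_le_sq_sum_of_nonneg fun _ _ => norm_nonneg _

theorem continuous_smoothModel_left (hf : ∀ i, IsSmooth (L i) (f i)) (y : Blocks n N) :
    Continuous fun x => smoothModel f γ x y := by
  have h1 : ∀ i, Continuous (f i) := fun i => (hf i).1.continuous
  have h2 : ∀ i, Continuous (gradient (f i)) := fun i => (hf i).2.continuous
  unfold smoothModel
  fun_prop

theorem lowerSemicontinuous_cost (hf : ∀ i, IsSmooth (L i) (f i)) (hg : LowerSemicontinuous g) :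
    LowerSemicontinuous (cost f g) := by
  have h1 : ∀ i, Continuous (f i) := fun i => (hf i).1.continuous
  have h2 : Continuous fun x : Blocks n N => ((1 / (N : ℝ) * ∑ i, f i (x i) : ℝ) : EReal) :=
    continuous_coe_real_ereal.comp (by fun_prop)
  have h3 : Continuous fun x : Blocks n N => ∑ i, x i := by fun_prop
  exact h2.lowerSemicontinuous.add' (hg.comp h3) fun x =>
    EReal.continuousAt_add (.inl (EReal.coe_ne_top _)) (.inl (EReal.coe_ne_bot _))

/-- The residual of the optimality condition of the model at `x`, as a gradient correction:
`∇F(z) - ∇F(x) - Γ⁻¹(z - x)` with `F(x) = (1/N) ∑ᵢ fᵢ(xᵢ)` and `Γ = diag(γᵢ)`. -/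
noncomputable def modelResidual (f : Fin N → Vec n → ℝ) (γ : Fin N → ℝ) (x z : Blocks n N) :
    Blocks n N :=
  WithLp.toLp 2 fun i =>
    (1 / (N : ℝ)) • (gradient (f i) (z i) - gradient (f i) (x i)) - (1 / γ i) • (z i - x i)

theorem modelResidual_self (x : Blocks n N) : modelResidual f γ x x = 0 := by
  ext i j
  simp [modelResidual]

theorem norm_modelResidual_le (hN : 0 < N) (hf : ∀ i, IsSmooth (L i) (f i)) (hγ : ∀ i, 0 < γ i)
    (hγL : ∀ i, γ i * (L i : ℝ) < N) (x z : Blocks n N) :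
    ‖modelResidual f γ x z‖ ≤ 2 * (∑ i, 1 / γ i) * ∑ i, ‖z i - x i‖ := by
  have h0 : ∀ i, 0 ≤ 1 / γ i := fun i => by have := hγ i; positivity
  refine (norm_le_sum_norm _).trans ?_
  rw [Finset.mul_sum]
  refine Finset.sum_le_sum fun i _ => ?_
  have h1 := norm_sub_le ((1 / (N : ℝ)) • (gradient (f i) (z i) - gradient (f i) (x i)))
    ((1 / γ i) • (z i - x i))
  rw [norm_smul, norm_smul, Real.norm_of_nonneg (h0 i),
    Real.norm_of_nonneg (by positivity : (0 : ℝ) ≤ 1 / N)] at h1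
  have h2 : 1 / (N : ℝ) * ‖gradient (f i) (z i) - gradient (f i) (x i)‖ ≤
      1 / γ i * ‖z i - x i‖ := by
    calc _ ≤ 1 / (N : ℝ) * (L i * ‖z i - x i‖) := by
          gcongr; exact (hf i).norm_gradient_sub_le _ _
      _ = L i / N * ‖z i - x i‖ := by ring
      _ ≤ _ := mul_le_mul_of_nonneg_right (div_lt_one_div_of_stepsize hN hγ hγL i).le
          (norm_nonneg _)
  have h3 : 1 / γ i ≤ ∑ i, 1 / γ i :=
    Finset.single_le_sum (f := fun i => 1 / γ i) (fun i _ => h0 i) (Finset.mem_univ i)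
  have h4 := mul_le_mul_of_nonneg_right h3 (norm_nonneg (z i - x i))
  refine h1.trans ?_
  linarith

/-- The error `F(y) - smoothModel x y` of the model has gradient `modelResidual` at `y = z`, and its
curvature is bounded below by that of the `fᵢ` and of the proximal term. -/
theorem inner_modelResidual_sub_le (hN : 0 < N) (hf : ∀ i, IsSmooth (L i) (f i))
    (hγ : ∀ i, 0 < γ i) (hγL : ∀ i, γ i * (L i : ℝ) < N) (x y z : Blocks n N) :
    1 / (N : ℝ) * ∑ i, f i (z i) + inner ℝ (modelResidual f γ x z) (y - z)
      - (∑ i, 1 / γ i) * ‖y - z‖ ^ 2 ≤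
    1 / (N : ℝ) * ∑ i, f i (y i) + smoothModel f γ x z - smoothModel f γ x y := by
  have h0 : ∀ i, 0 ≤ 1 / γ i := fun i => by have := hγ i; positivity
  have h1 : ∑ i, 1 / γ i * ‖y i - z i‖ ^ 2 ≤ (∑ i, 1 / γ i) * ‖y - z‖ ^ 2 := by
    rw [PiLp.norm_sq_eq_of_L2]
    exact sum_mul_sq_le_sum_mul_sum_sq _ h0
  have h2 : inner ℝ (modelResidual f γ x z) (y - z) =
      ∑ i, inner ℝ (modelResidual f γ x z i) (y i - z i) := PiLp.inner_apply _ _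
  have h3 : ∑ i, (1 / (N : ℝ) * f i (z i) + inner ℝ (modelResidual f γ x z i) (y i - z i)
      - 1 / γ i * ‖y i - z i‖ ^ 2) ≤
      1 / (N : ℝ) * ∑ i, f i (y i) + smoothModel f γ x z - smoothModel f γ x y := by
    rw [smoothModel, smoothModel, Finset.mul_sum, ← Finset.sum_add_distrib,
      ← Finset.sum_sub_distrib]
    refine Finset.sum_le_sum fun i _ => ?_
    have h4 := (abs_le.1 ((hf i).abs_mul_sub_linearization_le (z i) (y i))).1
    have h5 := mul_le_mul_of_nonneg_right (div_lt_one_div_of_stepsize hN hγ hγL i).le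
      (sq_nonneg ‖y i - z i‖)
    have h6 : modelResidual f γ x z i =
      (1 / (N : ℝ)) • (gradient (f i) (z i) - gradient (f i) (x i)) - (1 / γ i) • (z i - x i) := rfl
    have h7 : 1 / (2 * γ i) = 1 / γ i / 2 := by ring
    have h8 : y i - x i = (z i - x i) + (y i - z i) := by abel
    have h9 : ‖y i - x i‖ ^ 2 = ‖z i - x i‖ ^ 2 + 2 * inner ℝ (z i - x i) (y i - z i)
      + ‖y i - z i‖ ^ 2 := by rw [h8, norm_add_sq_real]
    have h10 : inner ℝ (gradient (f i) (x i)) (y i - x i) =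
      inner ℝ (gradient (f i) (x i)) (z i - x i) + inner ℝ (gradient (f i) (x i)) (y i - z i) := by
      rw [h8, inner_add_right]
    rw [h6, inner_sub_left, real_inner_smul_left, real_inner_smul_left, inner_sub_left, h7, h9, h10]
    linarith
  rw [Finset.sum_sub_distrib, Finset.sum_add_distrib, ← Finset.mul_sum, ← h2] at h3
  linarith

/-- Fermat's rule for the model: the residual is a regular subgradient of the cost. -/
theorem modelResidual_mem_regSubdiff (hN : 0 < N) (hf : ∀ i, IsSmooth (L i) (f i))
    (hγ : ∀ i, 0 < γ i) (hγL : ∀ i, γ i * (L i : ℝ) < N) {x z : Blocks n N}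
    (hmin : IsModelMin f g γ x z) {r : ℝ} (hr : g (∑ i, z i) = r) :
    modelResidual f γ x z ∈ regSubdiff (cost f g) z := by
  have hcost : cost f g z = ((1 / (N : ℝ) * ∑ i, f i (z i) + r : ℝ) : EReal) := by
    rw [cost, hr, EReal.coe_add]
  have h0 : 0 ≤ ∑ i, 1 / γ i := Finset.sum_nonneg fun i _ => by have := hγ i; positivity
  refine ⟨by simp [hcost, -EReal.coe_add], by simp [hcost, -EReal.coe_add], fun ε hε => ?_⟩
  filter_upwards [Metric.ball_mem_nhds z (div_pos hε (by linarith : 0 < (∑ i, 1 / γ i) + 1))]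
    with y hy
  rw [Metric.mem_ball, dist_eq_norm, lt_div_iff₀ (by linarith)] at hy
  have h1 : (∑ i, 1 / γ i) * ‖y - z‖ ^ 2 ≤ ε * ‖y - z‖ := by
    have := norm_nonneg (y - z)
    nlinarith
  have h2 := inner_modelResidual_sub_le hN hf hγ hγL x y z
  have h3 := hmin y
  rw [hcost, cost]
  rw [hr] at h3
  generalize g (∑ i, y i) = t at h3 ⊢
  induction t with
  | bot =>
    rw [EReal.add_bot, le_bot_iff, ← EReal.coe_add] at h3
    exact absurd h3 (EReal.coe_ne_bot _)
  | top => rw [EReal.coe_add_top]; exact le_top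
  | coe t =>
    norm_cast at h3 ⊢
    linarith

theorem regSubdiff_subset_subdiff {E : Type*} [NormedAddCommGroup E] [InnerProductSpace ℝ E]
    (h : E → EReal) (x : E) : regSubdiff h x ⊆ subdiff h x := fun v hv =>
  ⟨hv.1, hv.2.1, fun _ => x, fun _ => v, tendsto_const_nhds, tendsto_const_nhds, fun _ => hv,
    tendsto_const_nhds⟩

/-- If `zⱼ` minimizes the model at `xⱼ`, and both sequences tend to `a`, then `a` minimizes the
model at `a` and its cost is the limit of the minimal values. -/
theorem isModelMin_of_tendsto (hN : 0 < N) (hf : ∀ i, IsSmooth (L i) (f i))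
    (hγ : ∀ i, 0 < γ i) (hγL : ∀ i, γ i * (L i : ℝ) < N) (hg : LowerSemicontinuous g)
    {x z : ℕ → Blocks n N} {V : ℕ → ℝ} {a : Blocks n N} {Vlim : ℝ}
    (hmin : ∀ j, IsModelMin f g γ (x j) (z j))
    (hV : ∀ j, (V j : EReal) = smoothModel f γ (x j) (z j) + g (∑ i, z j i))
    (hx : Tendsto x atTop (𝓝 a)) (hz : Tendsto z atTop (𝓝 a)) (hVlim : Tendsto V atTop (𝓝 Vlim)) :
    cost f g a = Vlim ∧ IsModelMin f g γ a a := by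
  have hVlim' : Tendsto (fun j => (V j : EReal)) atTop (𝓝 (Vlim : EReal)) :=
    (continuous_coe_real_ereal.tendsto _).comp hVlim
  have hle : ∀ y, (Vlim : EReal) ≤ smoothModel f γ a y + g (∑ i, y i) := by
    intro y
    have h1 : Tendsto (fun j => (smoothModel f γ (x j) y : EReal)) atTop
        (𝓝 (smoothModel f γ a y : EReal)) :=
      (continuous_coe_real_ereal.tendsto _).comp
        (((continuous_smoothModel_left hf y).tendsto a).comp hx)
    have h2 : Tendsto (fun j => (smoothModel f γ (x j) y : EReal) + g (∑ i, y i)) atTop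
        (𝓝 ((smoothModel f γ a y : EReal) + g (∑ i, y i))) :=
      Tendsto.comp (EReal.continuousAt_add (p := (_, _)) (.inl (EReal.coe_ne_top _))
        (.inl (EReal.coe_ne_bot _))) (h1.prodMk_nhds tendsto_const_nhds)
    exact le_of_tendsto_of_tendsto' hVlim' h2 fun j => by rw [hV j]; exact hmin j y
  have hge : cost f g a ≤ Vlim := by
    by_contra! hlt
    obtain ⟨c, hc1, hc2⟩ := EReal.lt_iff_exists_real_btwn.1 hlt
    have h1 := hz.eventually (lowerSemicontinuous_cost hf hg a c hc2)
    have h2 := hVlim.eventually (gt_mem_nhds (EReal.coe_lt_coe_iff.1 hc1))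
    obtain ⟨j, hj1, hj2⟩ := (h1.and h2).exists
    have h3 : cost f g (z j) ≤ V j := by
      rw [hV j, cost]
      exact add_le_add_left (EReal.coe_le_coe_iff.2 (sum_le_smoothModel hN hf hγ hγL _ _)) _
    exact absurd (hj1.trans_le h3) (by exact_mod_cast hj2.le.not_gt)
  have heq : cost f g a = Vlim := by
    refine le_antisymm hge ?_
    have := hle a
    rwa [smoothModel_self] at this
  refine ⟨heq, fun y => ?_⟩
  rw [smoothModel_self]
  exact heq.le.trans (hle y)

end ModelProperties

/-! ### Error bounds from the Kurdyka–Łojasiewicz inequality -/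

section KL

/-- A Łojasiewicz bound of exponent `θ` on `s` and a quadratic error `e - s` combine to a bound of
exponent `max θ (1/2)` on `e`. -/
theorem rpow_max_le {θ e s A D R : ℝ} (hθ : 0 < θ) (he : 0 ≤ e) (hA : 0 ≤ A) (hD : 0 ≤ D)
    (hR0 : 0 ≤ R) (hR1 : R ≤ 1) (h1 : e ≤ s + A * R ^ 2)
    (h2 : 0 < s → s ^ θ ≤ D * R) :
    e ^ (max θ (1 / 2)) ≤ (A + D ^ (1 / θ)) ^ (max θ (1 / 2)) * R := by
  set p := max θ (1 / 2) with hp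
  have hp0 : 0 < p := lt_max_of_lt_left hθ
  have hpθ : 1 / p ≤ 1 / θ := one_div_le_one_div_of_le hθ (le_max_left _ _)
  have hp2 : 1 / p ≤ 2 := by
    rw [div_le_iff₀ hp0]; linarith [le_max_right θ (1 / 2)]
  have hp0' : 0 ≤ 1 / p := by positivity
  have hD' : 0 ≤ D ^ (1 / θ) := Real.rpow_nonneg hD _
  have hR2 : R ^ 2 ≤ R ^ (1 / p) := by
    rw [← Real.rpow_natCast]
    exact Real.rpow_le_rpow_of_exponent_ge' hR0 hR1 hp0' (by exact_mod_cast hp2)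
  have hs : s ≤ D ^ (1 / θ) * R ^ (1 / p) := by
    rcases le_or_gt s 0 with hs | hs
    · exact hs.trans (mul_nonneg hD' (Real.rpow_nonneg hR0 _))
    · calc s = (s ^ θ) ^ (1 / θ) := by
            rw [← Real.rpow_mul hs.le, mul_one_div_cancel hθ.ne', Real.rpow_one]
        _ ≤ (D * R) ^ (1 / θ) :=
            Real.rpow_le_rpow (Real.rpow_nonneg hs.le _) (h2 hs) (by positivity)
        _ = D ^ (1 / θ) * R ^ (1 / θ) := Real.mul_rpow hD hR0
        _ ≤ _ := mul_le_mul_of_nonneg_left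
            (Real.rpow_le_rpow_of_exponent_ge' hR0 hR1 hp0' hpθ) hD'
  have hle : e ≤ (A + D ^ (1 / θ)) * R ^ (1 / p) := by
    have := mul_le_mul_of_nonneg_left hR2 hA
    linarith
  calc e ^ p ≤ ((A + D ^ (1 / θ)) * R ^ (1 / p)) ^ p := Real.rpow_le_rpow he hle hp0.le
    _ = (A + D ^ (1 / θ)) ^ p * (R ^ (1 / p)) ^ p :=
        Real.mul_rpow (by positivity) (Real.rpow_nonneg hR0 _)
    _ = _ := by rw [← Real.rpow_mul hR0, one_div_mul_cancel hp0.ne', Real.rpow_one]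

variable {E : Type*} [NormedAddCommGroup E] [InnerProductSpace ℝ E]

/-- The KL inequality as a bound on the function gap by the norm of a subgradient. -/
theorem HasKLAt.exists_rpow_le {h : E → EReal} {θ : ℝ} {a : E} (hKL : HasKLAt h θ a)
    (hθ : θ < 1) {α : ℝ} (ha : h a = α) :
    ∃ ε η D : ℝ, 0 < ε ∧ 0 < η ∧ 0 < D ∧ ∀ (w v : E) (β : ℝ), ‖w - a‖ < ε → h w = β → α < β →
      β < α + η → v ∈ subdiff h w → (β - α) ^ θ ≤ D * ‖v‖ := by
  obtain ⟨ε, η, ϱ, hε, hη, hϱ, H⟩ := hKL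
  refine ⟨ε, η, ϱ * (1 - θ), hε, hη, mul_pos hϱ (by linarith), fun w v β hw hβ h1 h2 hv => ?_⟩
  have h3 := H w hw (by rw [ha, hβ]; exact_mod_cast h1)
    (by rw [ha, hβ]; exact_mod_cast h2)
  have hs : 0 < β - α := sub_pos.2 h1
  have h4 : (h w - h a).toReal = β - α := by
    rw [ha, hβ, ← EReal.coe_sub, EReal.toReal_coe]
  have h5 : deriv (fun s : ℝ => ϱ * s ^ (1 - θ)) (β - α) = ϱ * ((1 - θ) * (β - α) ^ (-θ)) := by
    have := ((Real.hasDerivAt_rpow_const (p := 1 - θ) (Or.inl hs.ne')).const_mul ϱ).deriv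
    rw [this]
    congr 3
    ring
  have h6 : Metric.infEDist 0 (subdiff h w) ≤ ENNReal.ofReal ‖v‖ := by
    refine (Metric.infEDist_le_edist_of_mem hv).trans ?_
    rw [edist_dist, dist_zero_left]
  have hpow : 0 < (β - α) ^ θ := Real.rpow_pos_of_pos hs _
  have h7 : 1 ≤ ϱ * ((1 - θ) * (β - α) ^ (-θ)) * ‖v‖ := by
    rw [h4, h5] at h3
    have h8 := h3.trans (mul_le_mul_right h6 _)
    rw [← ENNReal.ofReal_mul' (norm_nonneg v)] at h8
    exact ENNReal.one_le_ofReal.1 h8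
  rw [Real.rpow_neg hs.le] at h7
  have h9 : ϱ * ((1 - θ) * ((β - α) ^ θ)⁻¹) * ‖v‖ = ϱ * (1 - θ) * ‖v‖ / (β - α) ^ θ := by
    field_simp
  rw [h9, one_le_div hpow] at h7
  exact h7

/-- A uniform error bound for the values `V k` in terms of the residuals `R k`, from the KL property
at the cluster points of `z` only: if no constant worked, a subsequence violating the bound with
constants tending to infinity would accumulate at a point where the KL property fails. -/
theorem exists_eventually_rpow_le_of_hasKLAt [ProperSpace E] {h : E → EReal} {θ : ℝ}
    (hθ0 : 0 < θ) (hθ1 : θ < 1) {z v : ℕ → E} {V R φ : ℕ → ℝ} {Vlim A B : ℝ} (hA : 0 ≤ A)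
    (hB : 0 ≤ B) (hbdd : Bornology.IsBounded (Set.range z)) (hφ : ∀ k, h (z k) = φ k)
    (hv : ∀ k, v k ∈ subdiff h (z k)) (hvR : ∀ k, ‖v k‖ ≤ B * R k) (hR : ∀ k, 0 ≤ R k)
    (hφV : ∀ k, φ k ≤ V k) (hVφ : ∀ k, V k ≤ φ k + A * R k ^ 2) (hVge : ∀ k, Vlim ≤ V k)
    (hVlim : Tendsto V atTop (𝓝 Vlim)) (hRlim : Tendsto R atTop (𝓝 0))
    (hcluster : ∀ (σ : ℕ → ℕ) (a : E), Tendsto σ atTop atTop →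
      Tendsto (fun j => z (σ j)) atTop (𝓝 a) → h a = Vlim ∧ HasKLAt h θ a) :
    ∃ C : ℝ, 0 < C ∧ ∃ K, ∀ k ≥ K, (V k - Vlim) ^ (max θ (1 / 2)) ≤ C * R k := by
  by_contra! hcon
  choose κ hκ1 hκ2 using fun m : ℕ => hcon ((m : ℝ) + 1) (by positivity) m
  obtain ⟨a, -, χ, hχ, hlim⟩ := tendsto_subseq_of_bounded hbdd
    (fun m => Set.mem_range_self (f := z) (κ m))
  have hσ : Tendsto (fun j => κ (χ j)) atTop atTop :=
    (tendsto_atTop_mono hκ1 tendsto_id).comp hχ.tendsto_atTop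
  obtain ⟨ha, hKL⟩ := hcluster _ a hσ hlim
  obtain ⟨ε, η, D, hε, hη, hD, H⟩ := hKL.exists_rpow_le hθ1 ha
  set C := (A + (D * B) ^ (1 / θ)) ^ (max θ (1 / 2)) with hC
  have e1 : ∀ᶠ j in atTop, ‖z (κ (χ j)) - a‖ < ε := by
    have := (tendsto_iff_norm_sub_tendsto_zero.1 hlim).eventually (gt_mem_nhds hε)
    exact this
  have e2 := hσ.eventually (hVlim.eventually (gt_mem_nhds (show Vlim < Vlim + η by linarith)))
  have e3 := hσ.eventually (hRlim.eventually (gt_mem_nhds (zero_lt_one' ℝ)))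
  have e4 : ∀ᶠ j in atTop, C < (χ j : ℝ) :=
    (tendsto_natCast_atTop_atTop.comp hχ.tendsto_atTop).eventually_gt_atTop C
  obtain ⟨j, h1, h2, h3, h4⟩ := (e1.and (e2.and (e3.and e4))).exists
  have h5 := hκ2 (χ j)
  set k := κ (χ j)
  have h6 := rpow_max_le (e := V k - Vlim) (s := φ k - Vlim) hθ0 (sub_nonneg.2 (hVge k)) hA
    (mul_nonneg hD.le hB) (hR k) h3.le (by linarith [hVφ k]) (fun hs => by
      rw [mul_assoc]
      exact (H (z k) (v k) (φ k) h1 (hφ k) (by linarith) (by linarith [hφV k]) (hv k)).trans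
        (mul_le_mul_of_nonneg_left (hvR k) hD.le))
  have h7 : C * R k ≤ ((χ j : ℝ) + 1) * R k :=
    mul_le_mul_of_nonneg_right (by linarith) (hR k)
  linarith

end KL

/-! ### The iterates of the block-coordinate method -/

section Run

variable {n N : ℕ} {f : Fin N → Vec n → ℝ} {g : Vec n → EReal} {γ : Fin N → ℝ} {L : Fin N → NNReal}
  {I : ℕ → Finset (Fin N)}

/-- The block-coordinate iterates behind the method: the selected blocks of `x` are replaced by
those of `z`, the others are kept. -/
noncomputable def blockIterates (I : ℕ → Finset (Fin N)) (xinit : Fin N → Vec n)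
    (z : ℕ → Blocks n N) : ℕ → Blocks n N
  | 0 => WithLp.toLp 2 xinit
  | k + 1 => WithLp.toLp 2 fun i => if i ∈ I k then z k i else blockIterates I xinit z k i

theorem blockIterates_succ_of_mem {xinit : Fin N → Vec n} {z : ℕ → Blocks n N} {k : ℕ} {i : Fin N}
    (hi : i ∈ I k) : blockIterates I xinit z (k + 1) i = z k i := by
  simp [blockIterates, hi]

theorem blockIterates_succ_of_notMem {xinit : Fin N → Vec n} {z : ℕ → Blocks n N} {k : ℕ}
    {i : Fin N} (hi : i ∉ I k) :
    blockIterates I xinit z (k + 1) i = blockIterates I xinit z k i := by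
  simp [blockIterates, hi]

variable {xinit : Fin N → Vec n} {s : ℕ → Fin N → Vec n} {sTilde w : ℕ → Vec n}

theorem IsRun.eq_forwardStep (hrun : IsRun f g γ I xinit s sTilde w) (k : ℕ) (i : Fin N) :
    s k i = forwardStep f γ i (blockIterates I xinit (fun k => output γ (s k) (w k)) k i) := by
  induction k with
  | zero => exact hrun.s_zero i
  | succ k ih =>
    by_cases hi : i ∈ I k
    · rw [blockIterates_succ_of_mem hi, hrun.s_update k i hi]
      rfl
    · rw [blockIterates_succ_of_notMem hi, hrun.s_keep k i hi, ih]

theorem IsRun.sTilde_eq (hrun : IsRun f g γ I xinit s sTilde w) (k : ℕ) :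
    sTilde k = ∑ i, s k i := by
  induction k with
  | zero => exact hrun.sTilde_zero
  | succ k ih =>
    have h1 : ∑ i ∈ I k, (forwardStep f γ i (s k i + γ i • w k) - s k i) =
        ∑ i, (s (k + 1) i - s k i) := by
      rw [Finset.sum_congr rfl fun i hi => by rw [← hrun.s_update k i hi]]
      refine Finset.sum_subset (Finset.subset_univ _) fun i _ hi => ?_
      rw [hrun.s_keep k i hi, sub_self]
    rw [hrun.sTilde_update, h1, Finset.sum_sub_distrib, ih, add_sub_cancel]

theorem norm_forwardStep_sub_le (hN : 0 < N) (hf : ∀ i, IsSmooth (L i) (f i))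
    (hγ : ∀ i, 0 < γ i) (hγL : ∀ i, γ i * (L i : ℝ) < N) (i : Fin N) (u u' : Vec n) :
    ‖forwardStep f γ i u - forwardStep f γ i u'‖ ≤ 2 * ‖u - u'‖ := by
  have hN' : (0 : ℝ) < N := by exact_mod_cast hN
  have h0 : 0 ≤ γ i / (N : ℝ) := by have := hγ i; positivity
  have h1 : forwardStep f γ i u - forwardStep f γ i u' =
      (u - u') - (γ i / (N : ℝ)) • (gradient (f i) u - gradient (f i) u') := by
    rw [forwardStep, forwardStep, smul_sub]; abel
  have h2 := norm_sub_le (u - u') ((γ i / (N : ℝ)) • (gradient (f i) u - gradient (f i) u'))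
  rw [norm_smul, Real.norm_of_nonneg h0] at h2
  have h3 : γ i / (N : ℝ) * ‖gradient (f i) u - gradient (f i) u'‖ ≤ 1 * ‖u - u'‖ := by
    calc _ ≤ γ i / (N : ℝ) * (L i * ‖u - u'‖) := by
          gcongr; exact (hf i).norm_gradient_sub_le _ _
      _ = γ i * L i / N * ‖u - u'‖ := by ring
      _ ≤ _ := by
          gcongr
          exact (div_le_one hN').2 (hγL i).le
  rw [h1]
  linarith

/-- The output is a Lipschitz function of the block iterates, because the proximal mapping of a
convex function is nonexpansive. -/
theorem IsRun.norm_output_sub_le (hrun : IsRun f g γ I xinit s sTilde w) (hN : 0 < N)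
    (hf : ∀ i, IsSmooth (L i) (f i)) (hg : IsProper g) (hconv : IsConvex g)
    (hγ : ∀ i, 0 < γ i) (hγL : ∀ i, γ i * (L i : ℝ) < N) {x : ℕ → Blocks n N}
    (hx : ∀ k i, s k i = forwardStep f γ i (x k i)) (j k : ℕ) (i : Fin N) :
    ‖output γ (s j) (w j) i - output γ (s k) (w k) i‖ ≤ 6 * ∑ l, ‖x j l - x k l‖ := by
  have hne : (Finset.univ : Finset (Fin N)).Nonempty := ⟨⟨0, hN⟩, Finset.mem_univ _⟩
  have hG : 0 < ∑ i, γ i := Finset.sum_pos (fun i _ => hγ i) hne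
  set S := ∑ l, ‖x j l - x k l‖ with hS
  obtain ⟨p, hp, hwp⟩ := hrun.w_mem j
  obtain ⟨p', hp', hwp'⟩ := hrun.w_mem k
  have hs : ∀ l, ‖s j l - s k l‖ ≤ 2 * ‖x j l - x k l‖ := fun l => by
    rw [hx, hx]; exact norm_forwardStep_sub_le hN hf hγ hγL l _ _
  have hsT : ‖sTilde j - sTilde k‖ ≤ 2 * S := by
    rw [hrun.sTilde_eq, hrun.sTilde_eq, ← Finset.sum_sub_distrib, hS, Finset.mul_sum]
    exact (norm_sum_le _ _).trans (Finset.sum_le_sum fun l _ => hs l)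
  have hpp := norm_sub_le_of_mem_prox hG hg hconv hp' hp
  have hww : γ i * ‖w j - w k‖ ≤ 4 * S := by
    have h1 : w j - w k = (∑ i, γ i)⁻¹ • ((p - p') - (sTilde j - sTilde k)) := by
      rw [hwp, hwp', ← smul_sub]; congr 1; abel
    rw [h1, norm_smul, Real.norm_of_nonneg (by positivity), ← mul_assoc, ← div_eq_mul_inv]
    have h2 : γ i / ∑ i, γ i ≤ 1 := (div_le_one hG).2
      (Finset.single_le_sum (f := γ) (fun i _ => (hγ i).le) (Finset.mem_univ i))
    have h3 := norm_sub_le (p - p') (sTilde j - sTilde k)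
    calc _ ≤ 1 * ‖(p - p') - (sTilde j - sTilde k)‖ := by gcongr
      _ ≤ _ := by linarith
  have h4 : output γ (s j) (w j) i - output γ (s k) (w k) i =
      (s j i - s k i) + γ i • (w j - w k) := by
    change (s j i + γ i • w j) - (s k i + γ i • w k) = _
    rw [smul_sub]; abel
  have h5 := norm_add_le (s j i - s k i) (γ i • (w j - w k))
  rw [norm_smul, Real.norm_of_nonneg (hγ i).le] at h5
  have h6 : ‖x j i - x k i‖ ≤ S :=
    Finset.single_le_sum (f := fun l => ‖x j l - x k l‖) (fun _ _ => norm_nonneg _)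
      (Finset.mem_univ i)
  rw [h4]
  linarith [hs i]

/-- Over a window in which every block is updated, the residual `z - x` at its start is bounded by
the steps made in it. -/
theorem sum_norm_sub_le_window {x z : ℕ → Blocks n N} {C : ℝ} {T : ℕ} (hC : 0 ≤ C)
    (hin : ∀ k, ∀ i ∈ I k, x (k + 1) i = z k i)
    (hz : ∀ j k i, ‖z j i - z k i‖ ≤ C * ∑ l, ‖x j l - x k l‖)
    (hI : ∀ (i : Fin N) (k : ℕ), ∃ j, k ≤ j ∧ j < k + T ∧ i ∈ I j) (k : ℕ) :
    ∑ i, ‖z k i - x k i‖ ≤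
      N * (C + 1) * ∑ j ∈ Finset.range T, ∑ i, ‖x (k + j + 1) i - x (k + j) i‖ := by
  set δ : ℕ → ℝ := fun j => ∑ i, ‖x (j + 1) i - x j i‖ with hδ
  have hδ0 : ∀ j, 0 ≤ δ j := fun j => Finset.sum_nonneg fun _ _ => norm_nonneg _
  change _ ≤ N * (C + 1) * ∑ j ∈ Finset.range T, δ (k + j)
  have hpath : ∀ m, ∑ i, ‖x (k + m) i - x k i‖ ≤ ∑ j ∈ Finset.range m, δ (k + j) := by
    intro m
    induction m with
    | zero => simp
    | succ m ih =>
      rw [Finset.sum_range_succ]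
      have : ∑ i, ‖x (k + (m + 1)) i - x k i‖ ≤
          ∑ i, (‖x (k + m) i - x k i‖ + ‖x (k + m + 1) i - x (k + m) i‖) :=
        Finset.sum_le_sum fun i _ => by
          have := norm_add_le (x (k + m) i - x k i) (x (k + m + 1) i - x (k + m) i)
          rwa [add_comm (x (k + m) i - x k i), sub_add_sub_cancel] at this
      rw [Finset.sum_add_distrib] at this
      exact this.trans (add_le_add_left ih _)
  have hpathT : ∀ m ≤ T, ∑ i, ‖x (k + m) i - x k i‖ ≤ ∑ j ∈ Finset.range T, δ (k + j) :=
    fun m hm => (hpath m).trans (Finset.sum_le_sum_of_subset_of_nonneg (Finset.range_mono hm)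
      fun _ _ _ => hδ0 _)
  have key : ∀ i, ‖z k i - x k i‖ ≤ (C + 1) * ∑ j ∈ Finset.range T, δ (k + j) := by
    intro i
    obtain ⟨j, hj1, hj2, hj⟩ := hI i k
    obtain ⟨m, rfl⟩ := Nat.exists_eq_add_of_le hj1
    have h1 := hz (k + m) k i
    have h2 := mul_le_mul_of_nonneg_left (hpathT m (by omega)) hC
    have h3 : ‖x (k + (m + 1)) i - x k i‖ ≤ _ :=
      (Finset.single_le_sum (f := fun i => ‖x (k + (m + 1)) i - x k i‖)
        (fun _ _ => norm_nonneg _) (Finset.mem_univ i)).trans (hpathT (m + 1) (by omega))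
    rw [← add_assoc, hin _ i hj] at h3
    have h4 := norm_add_le (z k i - z (k + m) i) (z (k + m) i - x k i)
    rw [sub_add_sub_cancel, norm_sub_rev (z k i) (z (k + m) i)] at h4
    linarith
  calc _ ≤ ∑ _i : Fin N, (C + 1) * ∑ j ∈ Finset.range T, δ (k + j) :=
        Finset.sum_le_sum fun i _ => key i
    _ = _ := by rw [Finset.sum_const, Finset.card_univ, Fintype.card_fin, nsmul_eq_mul, mul_assoc]

end Run

/-! ### Decrease of the minimal model value -/

section Lyapunov

variable {n N : ℕ} {f : Fin N → Vec n → ℝ} {g : Vec n → EReal} {γ : Fin N → ℝ} {L : Fin N → NNReal}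

theorem exists_decrease_constant (hN : 0 < N) (hγ : ∀ i, 0 < γ i)
    (hγL : ∀ i, γ i * (L i : ℝ) < N) :
    ∃ c : ℝ, 0 < c ∧ ∀ i, N * c ≤ (1 / γ i - L i / N) / 2 := by
  have : Nonempty (Fin N) := ⟨⟨0, hN⟩⟩
  have hN' : (0 : ℝ) < N := by exact_mod_cast hN
  obtain ⟨i₀, hi₀⟩ := Finite.exists_min fun i => (1 / γ i - L i / N) / 2
  have h := div_lt_one_div_of_stepsize hN hγ hγL i₀
  refine ⟨(1 / γ i₀ - L i₀ / N) / 2 / N, by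
    have : 0 < 1 / γ i₀ - L i₀ / N := by linarith
    positivity, fun i => ?_⟩
  rw [mul_div_cancel₀ _ hN'.ne']
  exact hi₀ i

/-- The minimal model value decreases by a multiple of the squared step of the block iterates. -/
theorem add_sq_le_of_isModelMin (hf : ∀ i, IsSmooth (L i) (f i)) {c : ℝ} (hc : 0 ≤ c)
    (hcγ : ∀ i, N * c ≤ (1 / γ i - L i / N) / 2) {x x' z z' : Blocks n N} {r r' : ℝ}
    {S : Finset (Fin N)} (hin : ∀ i ∈ S, x' i = z i) (hout : ∀ i ∉ S, x' i = x i)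
    (hmin : IsModelMin f g γ x' z') (hr : g (∑ i, z i) = r) (hr' : g (∑ i, z' i) = r') :
    smoothModel f γ x' z' + r' + c * (∑ i, ‖x' i - x i‖) ^ 2 ≤ smoothModel f γ x z + r := by
  have h1 := hmin z
  rw [hr, hr'] at h1
  norm_cast at h1
  have h2 := smoothModel_update_le (γ := γ) hf hin hout
  have h3 : ∑ i, ‖x' i - x i‖ = ∑ i ∈ S, ‖z i - x i‖ := by
    rw [← Finset.sum_subset (Finset.subset_univ S) fun i _ hi => by rw [hout i hi]; simp]
    exact Finset.sum_congr rfl fun i hi => by rw [hin i hi]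
  have h4 : (∑ i ∈ S, ‖z i - x i‖) ^ 2 ≤ N * ∑ i ∈ S, ‖z i - x i‖ ^ 2 := by
    refine sq_sum_le_card_mul_sum_sq.trans ?_
    have : S.card ≤ N := by simpa using S.card_le_univ
    gcongr
  have h5 : c * (∑ i ∈ S, ‖z i - x i‖) ^ 2 ≤
      ∑ i ∈ S, (1 / γ i - L i / N) / 2 * ‖z i - x i‖ ^ 2 := by
    calc _ ≤ c * (N * ∑ i ∈ S, ‖z i - x i‖ ^ 2) := by gcongr
      _ = ∑ i ∈ S, N * c * ‖z i - x i‖ ^ 2 := by rw [← Finset.mul_sum]; ring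
      _ ≤ _ := Finset.sum_le_sum fun i _ =>
        mul_le_mul_of_nonneg_right (hcγ i) (sq_nonneg _)
  rw [h3]
  linarith

theorem isBounded_cost_le (hcoercive : IsCoercive (cost f g)) (r : ℝ) :
    Bornology.IsBounded {x | cost f g x ≤ r} := by
  have h : ∀ᶠ x in Bornology.cobounded (Blocks n N), (r : EReal) < cost f g x :=
    hcoercive.eventually (lt_mem_nhds (EReal.coe_lt_top r))
  rw [Bornology.isBounded_def]
  filter_upwards [h] with x hx
  simpa using hx

/-- A coercive lower semicontinuous cost is bounded below on its sublevel sets. -/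
theorem exists_forall_le_of_cost_le (hf : ∀ i, IsSmooth (L i) (f i)) (hg : IsProper g)
    (hlsc : LowerSemicontinuous g) (hcoercive : IsCoercive (cost f g)) (r : ℝ) :
    ∃ m : ℝ, ∀ x (t : ℝ), cost f g x ≤ t → t ≤ r → m ≤ t := by
  have hb := isBounded_cost_le hcoercive r
  rcases Set.eq_empty_or_nonempty {x | cost f g x ≤ r} with he | hne
  · refine ⟨0, fun x t hx ht => ?_⟩
    have : x ∈ {x | cost f g x ≤ r} := hx.trans (EReal.coe_le_coe_iff.2 ht)
    simp [he] at this
  · obtain ⟨y, -, hy⟩ := ((lowerSemicontinuous_cost hf hlsc).lowerSemicontinuousOn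
      (closure {x | cost f g x ≤ r})).exists_isMinOn hne.closure hb.isCompact_closure
    have hbot : cost f g y ≠ ⊥ := by
      rw [cost]
      simp only [ne_eq, EReal.add_eq_bot_iff, EReal.coe_ne_bot, hg.1, or_self, not_false_eq_true]
    refine ⟨(cost f g y).toReal, fun x t hx ht => ?_⟩
    have h1 : cost f g y ≤ t :=
      (hy (subset_closure (hx.trans (EReal.coe_le_coe_iff.2 ht)))).trans hx
    have htop : cost f g y ≠ ⊤ := fun h => by
      rw [h] at h1; exact absurd h1 (not_le.2 (EReal.coe_lt_top t))
    rwa [← EReal.coe_toReal htop hbot, EReal.coe_le_coe_iff] at h1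

theorem window_sq_le {c : ℝ} {V δ : ℕ → ℝ} (hc : 0 ≤ c)
    (h : ∀ k, V (k + 1) + c * δ k ^ 2 ≤ V k) {T : ℕ} (hT : 1 ≤ T) (k : ℕ) :
    c / T * (∑ j ∈ Finset.range T, δ (k + j)) ^ 2 ≤ V k - V (k + T) := by
  have h1 : ∀ m, c * ∑ j ∈ Finset.range m, δ (k + j) ^ 2 ≤ V k - V (k + m) := by
    intro m
    induction m with
    | zero => simp
    | succ m ih =>
      rw [Finset.sum_range_succ, mul_add, ← add_assoc]
      linarith [h (k + m)]
  have hT' : (0 : ℝ) < T := by exact_mod_cast hT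
  have h2 : (∑ j ∈ Finset.range T, δ (k + j)) ^ 2 ≤ T * ∑ j ∈ Finset.range T, δ (k + j) ^ 2 := by
    simpa using sq_sum_le_card_mul_sum_sq (s := Finset.range T) (f := fun j => δ (k + j))
  calc _ ≤ c / T * (T * ∑ j ∈ Finset.range T, δ (k + j) ^ 2) := by gcongr
    _ = c * ∑ j ∈ Finset.range T, δ (k + j) ^ 2 := by field_simp
    _ ≤ _ := h1 T

end Lyapunov

end Sharing

theorem mainTheorem12 (n N : ℕ) (hN : 0 < N)
    (f : Fin N → Sharing.Vec n → ℝ) (L : Fin N → NNReal)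
    (hf : ∀ i, Sharing.IsSmooth (L i) (f i))
    (g : Sharing.Vec n → EReal)
    (hg_proper : Sharing.IsProper g) (hg_convex : Sharing.IsConvex g)
    (hg_lsc : LowerSemicontinuous g)
    (θ : ℝ) (hθ_pos : 0 < θ) (hθ_lt : θ < 1)
    (hKL : Sharing.HasKL (Sharing.cost f g) θ)
    (hcoercive : Sharing.IsCoercive (Sharing.cost f g))
    -- stepsizes `γᵢ ∈ (0, N / Lᵢ)`, where `N / 0 = ∞`
    (γ : Fin N → ℝ) (hγ_pos : ∀ i, 0 < γ i) (hγ_lt : ∀ i, γ i * (L i : ℝ) < N)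
    (I : ℕ → Finset (Fin N)) (hI : Sharing.EssentiallyCyclic I)
    (xinit : Fin N → Sharing.Vec n)
    (s : ℕ → Fin N → Sharing.Vec n) (sTilde w : ℕ → Sharing.Vec n)
    (hrun : Sharing.IsRun f g γ I xinit s sTilde w) :
    ∃ xstar : Sharing.Blocks n N,
      Filter.Tendsto (fun k => Sharing.output γ (s k) (w k)) Filter.atTop (nhds xstar) ∧
      Sharing.IsStationary (Sharing.cost f g) xstar ∧
      (θ ≤ 1 / 2 →
        Sharing.ConvergesRLinearly (fun k => Sharing.output γ (s k) (w k)) xstar) := by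
  open Sharing in
  obtain ⟨T, hT, hIT⟩ := hI
  have hN' : (0 : ℝ) < N := by exact_mod_cast hN
  have hT' : (0 : ℝ) < T := by exact_mod_cast hT
  set z : ℕ → Blocks n N := fun k => output γ (s k) (w k) with hz
  set x : ℕ → Blocks n N := blockIterates I xinit z with hx
  have hin : ∀ k, ∀ i ∈ I k, x (k + 1) i = z k i := fun k i hi => blockIterates_succ_of_mem hi
  have hout : ∀ k, ∀ i ∉ I k, x (k + 1) i = x k i := fun k i hi => blockIterates_succ_of_notMem hi
  have hs : ∀ k i, s k i = forwardStep f γ i (x k i) := hrun.eq_forwardStep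
  have hstep : ∀ k, IsModelMin f g γ (x k) (z k) ∧ ∃ r : ℝ, g (∑ i, z k i) = r := by
    intro k
    obtain ⟨p, hp, hw⟩ := hrun.w_mem k
    obtain ⟨r, hr⟩ := exists_coe_eq_of_mem_prox hg_proper hp
    rw [hrun.sTilde_eq] at hp hw
    obtain ⟨h1, h2⟩ := isModelMin_output hN f g hγ_pos (hs k) hp hw
    exact ⟨h1, r, by rw [← hr, ← h2]⟩
  have hmin : ∀ k, IsModelMin f g γ (x k) (z k) := fun k => (hstep k).1
  choose r hr using fun k => (hstep k).2
  set V : ℕ → ℝ := fun k => smoothModel f γ (x k) (z k) + r k with hVdef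
  set φ : ℕ → ℝ := fun k => 1 / (N : ℝ) * ∑ i, f i (z k i) + r k with hφdef
  set R : ℕ → ℝ := fun k => ∑ i, ‖z k i - x k i‖ with hRdef
  set δ : ℕ → ℝ := fun k => ∑ i, ‖x (k + 1) i - x k i‖ with hδdef
  have hφ : ∀ k, cost f g (z k) = φ k := fun k => by rw [cost, hr, hφdef, EReal.coe_add]
  have hR0 : ∀ k, 0 ≤ R k := fun k => Finset.sum_nonneg fun _ _ => norm_nonneg _
  have hφV : ∀ k, φ k ≤ V k := fun k =>
    add_le_add_left (sum_le_smoothModel hN hf hγ_pos hγ_lt (x k) (z k)) (r k)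
  have hVφ : ∀ k, V k ≤ φ k + (∑ i, 1 / γ i) * R k ^ 2 := fun k => by
    have := smoothModel_le hN hf hγ_pos hγ_lt (x k) (z k)
    simp only [hVdef, hφdef, hRdef]
    linarith
  obtain ⟨c, hc, hcγ⟩ := exists_decrease_constant hN hγ_pos hγ_lt
  have hdec : ∀ k, V (k + 1) + c * δ k ^ 2 ≤ V k := fun k =>
    add_sq_le_of_isModelMin hf hc.le hcγ (hin k) (hout k) (hmin (k + 1)) (hr k) (hr (k + 1))
  have hanti : Antitone V := antitone_nat_of_succ_le fun k => by
    have : 0 ≤ c * δ k ^ 2 := by positivity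
    linarith [hdec k]
  have hcostV : ∀ k, cost f g (z k) ≤ (V k : EReal) := fun k => by
    rw [hφ]; exact EReal.coe_le_coe_iff.2 (hφV k)
  obtain ⟨m, hm⟩ := exists_forall_le_of_cost_le hf hg_proper hg_lsc hcoercive (V 0)
  have hVlim : Tendsto V atTop (𝓝 (⨅ k, V k)) := tendsto_atTop_ciInf hanti
    ⟨m, by rintro _ ⟨k, rfl⟩; exact hm _ _ (hcostV k) (hanti (Nat.zero_le k))⟩
  set Vlim := ⨅ k, V k
  have hVge : ∀ k, Vlim ≤ V k := hanti.le_of_tendsto hVlim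
  have hbdd : Bornology.IsBounded (Set.range z) :=
    (isBounded_cost_le hcoercive (V 0)).subset (by
      rintro _ ⟨k, rfl⟩
      exact (hcostV k).trans (EReal.coe_le_coe_iff.2 (hanti (Nat.zero_le k))))
  have hwin : ∀ k, c / T * (∑ j ∈ Finset.range T, δ (k + j)) ^ 2 ≤ V k - V (k + T) :=
    window_sq_le hc.le hdec hT
  have hres : ∀ k, R k ≤ N * (6 + 1) * ∑ j ∈ Finset.range T, δ (k + j) :=
    sum_norm_sub_le_window (by norm_num) hin
      (hrun.norm_output_sub_le hN hf hg_proper hg_convex hγ_pos hγ_lt hs) hIT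
  have hRlim : Tendsto R atTop (𝓝 0) := by
    have h1 : Tendsto (fun k => V k - V (k + T)) atTop (𝓝 0) := by
      simpa using hVlim.sub (hVlim.comp (tendsto_add_atTop_nat T))
    have h2 : Tendsto (fun k => N * (6 + 1) * √((V k - V (k + T)) / (c / T))) atTop (𝓝 0) := by
      simpa using ((h1.div_const (c / T)).sqrt).const_mul ((N : ℝ) * (6 + 1))
    refine squeeze_zero hR0 (fun k => (hres k).trans ?_) h2
    refine mul_le_mul_of_nonneg_left (Real.le_sqrt_of_sq_le ?_) (by positivity)
    rw [le_div_iff₀ (by positivity), mul_comm]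
    exact hwin k
  have hzx : Tendsto (fun k => z k - x k) atTop (𝓝 0) :=
    squeeze_zero_norm (fun k => norm_le_sum_norm (z k - x k)) hRlim
  -- every cluster point of `z` is a stationary point with cost `Vlim`, so that the KL property holds
  -- there
  have hcluster : ∀ (σ : ℕ → ℕ) (a : Blocks n N), Tendsto σ atTop atTop →
      Tendsto (fun j => z (σ j)) atTop (𝓝 a) →
      cost f g a = Vlim ∧ IsStationary (cost f g) a := by
    intro σ a hσ ha
    have hxa : Tendsto (fun j => x (σ j)) atTop (𝓝 a) := by
      simpa using ha.sub (hzx.comp hσ)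
    obtain ⟨h1, h2⟩ := isModelMin_of_tendsto hN hf hγ_pos hγ_lt hg_lsc (fun j => hmin (σ j))
      (V := fun j => V (σ j)) (fun j => by rw [hr, hVdef, EReal.coe_add]) hxa ha (hVlim.comp hσ)
    refine ⟨h1, ?_⟩
    have hga : ∃ t : ℝ, g (∑ i, a i) = t := by
      have htop : g (∑ i, a i) ≠ ⊤ := fun h => by
        rw [cost, h, EReal.coe_add_top] at h1
        exact EReal.coe_ne_top _ h1.symm
      exact ⟨_, (EReal.coe_toReal htop (hg_proper.1 _)).symm⟩
    obtain ⟨t, ht⟩ := hga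
    have := modelResidual_mem_regSubdiff hN hf hγ_pos hγ_lt h2 ht
    rwa [modelResidual_self] at this
  have hA : 0 ≤ ∑ i, 1 / γ i := Finset.sum_nonneg fun i _ => by have := hγ_pos i; positivity
  obtain ⟨C, hC, K, hCK⟩ := exists_eventually_rpow_le_of_hasKLAt hθ_pos hθ_lt
    (v := fun k => modelResidual f γ (x k) (z k)) hA (by positivity : 0 ≤ 2 * ∑ i, 1 / γ i)
    hbdd hφ
    (fun k => regSubdiff_subset_subdiff _ _
      (modelResidual_mem_regSubdiff hN hf hγ_pos hγ_lt (hmin k) (hr k)))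
    (fun k => norm_modelResidual_le hN hf hγ_pos hγ_lt (x k) (z k)) hR0 hφV hVφ hVge hVlim hRlim
    (fun σ a hσ ha => by
      obtain ⟨h1, h2⟩ := hcluster σ a hσ ha
      exact ⟨h1, hKL a ⟨0, regSubdiff_subset_subdiff _ _ h2⟩⟩)
  have hp1 : max θ (1 / 2) < 1 := max_lt hθ_lt (by norm_num)
  -- one constant for both the error bound on `V` and the bound on `z - x`
  set D : ℝ := (C + 1) * (N * (6 + 1)) with hD
  have hS0 : ∀ k, 0 ≤ ∑ j ∈ Finset.range T, δ (k + j) := fun k =>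
    Finset.sum_nonneg fun _ _ => Finset.sum_nonneg fun _ _ => norm_nonneg _
  have hCR : ∀ k, (C + 1) * R k ≤ D * ∑ j ∈ Finset.range T, δ (k + j) := fun k => by
    rw [hD, mul_assoc (C + 1)]
    exact mul_le_mul_of_nonneg_left (hres k) (by linarith)
  obtain ⟨a, ha, hlin⟩ := exists_tendsto_of_window (p := max θ (1 / 2)) (c := c / T) (C := D)
    (T := T) (K := K) (e := fun k => V k - Vlim) (δ := δ) (x := x) (z := z)
    (lt_max_of_lt_left hθ_pos) hp1 (by positivity) (by positivity) hT
    (fun k => sub_nonneg.2 (hVge k)) (fun j k hjk => sub_le_sub_right (hanti hjk) _)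
    (by simpa using hVlim.sub_const Vlim)
    (fun k => norm_le_sum_norm (x (k + 1) - x k))
    (fun k => by
      have h1 : ‖z k - x k‖ ≤ R k := norm_le_sum_norm (z k - x k)
      have h2 : 0 ≤ C * R k := mul_nonneg hC.le (hR0 k)
      linarith [hCR k])
    (fun k hk => by
      have h1 : (V k - Vlim) ^ (max θ (1 / 2)) ≤ C * R k := hCK k hk
      linarith [hCR k, hR0 k])
    (fun k => by simpa using hwin k)
  exact ⟨a, ha, (hcluster id a tendsto_id ha).2, fun hθ => hlin (max_eq_right hθ)⟩
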